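/- **Conventions.** Let $V=\mathbb{C}^n$ be a finite-dimensional complex vector space (with its standard basis) and $N\ge 0$ an integer. $P$ is the flip $P(v\otimes v')=v'\otimes v$ on $V\otimes V$. For $Y\in\mathrm{End}(V)$ and $X\in \mathrm{End}(V\otimes V)$, $Y_i$ and $X_{ij}$ ($i\neq j$) denote the operators on a tensor power of $V$ acting as $Y$ in factor $i$, resp. as $X$ in the factors $i$ and $j$ (in this order), and trivially elsewhere; $\mathrm{Tr}_0$ is the partial trace over factor $0$ and $X^{t_1}$ the partial transpose in the first factor. "Generic" means outside a subset that is locally contained in the zero set of an analytic function which is not identically zero; genericity refers to $x\in\mathbb{C}$, $x \in\mathbb{C}^\times$, $(x,y)\in(\mathbb{C}^\times)^2$ or $\boldsymbol z\in(\mathbb{C}^\times)^N$, as appropriate. For operator-valued functions of $\boldsymbol z\in(\mathbb C^\times)^N$, $X\propto Y$ means $X(\boldsymbol z)=m(\boldsymbol z)Y(\boldsymbol z)$ for generic $\boldsymbol z$ and some meromorphic $m$ on $(\mathbb{C}^\times)^N$ that is generically nonzero; between constant operators, and pointwise in $x$, it means equality up to a nonzero scalar. **Data.** Let $R$ be an $\mathrm{End}(V\otimes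 V)$-valued meromorphic function on $\mathbb{C}$ such that $R(x)$ and $R(x)^{t_1}$ are invertible for generic $x$, and let $K^+,K^-$ be $\mathrm{End}(V)$-valued meromorphic functions on $\mathbb{C}$. Put $$\tilde R(x)=\bigl((R(x)^{t_1})^{-1}\bigr)^{t_1},\qquad K'_1(x)=\phi_{\tilde R}(K^+)_1(x)=\mathrm{Tr}_0\,K^+_0(x)\,P_{01}\,\tilde R_{01}(x^2).$$ For $\boldsymbol z=(z_1,\dots,z_N)\in(\mathbb{C}^\times)^N$ define the inhomogeneous boundary transfer matrix on $V^{\otimes N}$ by $$\mathcal T(x;\boldsymbol z)=\mathrm{Tr}_0\,K'_0(x)R_{01}(\tfrac1{xz_1})^{-1}\cdots R_{0N}(\tfrac1{xz_N})^{-1}K^-_0(x)R_{0N}(\tfrac{x}{z_N})\cdots R_{01}(\tfrac{x}{z_1}),$$ and the bqKZ transport matrices, for $1\le i\le N$, by $$\begin{aligned}\mathcal A_i(\boldsymbol z;p)={}&R_{i\,i-1}(\tfrac{pz_i}{z_{i-1}})\cdots R_{i1}(\tfrac{pz_i}{z_1})\,K^+_i(p^{1/2}z_i)\,R_{1i}(z_1z_i)\cdots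 R_{i-1\,i}(z_{i-1}z_i)\\&\cdot R_{i+1\,i}(z_{i+1}z_i)\cdots R_{Ni}(z_Nz_i)\,K^-_i(z_i)\,R_{Ni}(\tfrac{z_N}{z_i})^{-1}\cdots R_{i+1\,i}(\tfrac{z_{i+1}}{z_i})^{-1},\end{aligned}$$ where $p^{1/2}$ is the principal square root; only $p=1$, $p^{1/2}=1$, is used below. **Theorem.** Assume that $R$ satisfies the Yang–Baxter equation $$R_{12}(x/y)R_{13}(x)R_{23}(y)=R_{23}(y)R_{13}(x)R_{12}(x/y)\quad\text{for generic }x,y,$$ and is regular, i.e. $R$ is analytic at $1$ and $R(1)\propto P$. 1. For $1\le i\le N$ one has, as functions of $\boldsymbol z$, $\ \mathcal T(z_i;\boldsymbol z)\propto\mathcal A_i(\boldsymbol z;1)$. 2. If moreover $K^+$ and $K^-$ are boundary-unitary, i.e. $K^\pm(x)K^\pm(x^{-1})\propto \mathrm{Id}_V$ for generic $x$, then for $1\le i\le N$ the operator $\mathcal A_i(\boldsymbol z;1)$ is invertible for generic $\boldsymbol z$ and $\ \mathcal T(z_i^{-1};\boldsymbol z)\propto\mathcal A_i(\boldsymbol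 z;1)^{-1}$. 3. If, in addition to the assumptions of 2, the left and right reflection equations $$\begin{aligned}R_{12}(x/y)K^+_1(x)R_{21}(xy)K^+_2(y)&=K^+_2(y)R_{12}(xy)K^+_1(x)R_{21}(x/y),\\ R_{21}(x/y)K^-_1(x)R_{12}(xy)K^-_2(y)&=K^-_2(y)R_{21}(xy)K^-_1(x)R_{12}(x/y)\end{aligned}$$ hold for generic $x,y$, then for generic $\boldsymbol z$ one has $[\mathcal T(z_i^{\varepsilon};\boldsymbol z),\mathcal T(z_j^{\delta};\boldsymbol z)]=0$ for all $1\le i,j\le N$ and all signs $\varepsilon,\delta\in\{1,-1\}$. -/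

import Mathlib

open Filter Topology Matrix
open scoped Kronecker

namespace BoundaryQKZ

noncomputable section

/-! ### Generic points and meromorphic functions of several variables -/

section Generic

variable {E : Type*} [NormedAddCommGroup E] [NormedSpace ℂ E]

/-- `P` holds at generic points of the open set `U`: the points of `U` where `P` fails form a thin
set, i.e. near every point of `U` they are contained in the zero set of an analytic function which
does not vanish identically near that point. -/
def Generic (U : Set E) (P : E → Prop) : Prop :=
  ∀ w ∈ U, ∃ g : E → ℂ, AnalyticAt ℂ g w ∧ (∃ᶠ z in 𝓝 w, g z ≠ 0) ∧
    ∀ᶠ z in 𝓝 w, g z ≠ 0 → P z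

/-- `m` is a meromorphic function on the open set `U`: near every point of `U` it is a quotient of
two analytic functions, the denominator not vanishing identically. (The values of `m` on the zero
set of the denominator are irrelevant.) -/
def IsMeromorphicOn (U : Set E) (m : E → ℂ) : Prop :=
  ∀ w ∈ U, ∃ g h : E → ℂ, AnalyticAt ℂ g w ∧ AnalyticAt ℂ h w ∧ (∃ᶠ z in 𝓝 w, h z ≠ 0) ∧
    ∀ᶠ z in 𝓝 w, h z ≠ 0 → m z = g z / h z

/-- `X ∝ Y` on `U`: there is a meromorphic function `m`, not identically zero (hence generically
nonzero), with `X z = m z • Y z` for generic `z`. -/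
def Proportional {α : Type*} (U : Set E) (X Y : E → Matrix α α ℂ) : Prop :=
  ∃ m : E → ℂ, IsMeromorphicOn U m ∧ Generic U (fun z => m z ≠ 0) ∧
    Generic U (fun z => X z = m z • Y z)

end Generic

/-- The complex torus `(ℂ^×)^N`. -/
def torus (N : ℕ) : Set (Fin N → ℂ) := {z | ∀ i, z i ≠ 0}

/-- `ℂ^× × ℂ^×`. -/
def torusPair : Set (ℂ × ℂ) := {q | q.1 ≠ 0 ∧ q.2 ≠ 0}

/-! ### Operators on tensor products

The vector space is `V = ℂ^ι`. Operators on `V` are matrices indexed by `ι`, operators on `V ⊗ V`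
are matrices indexed by `ι × ι`, and operators on `⨂_{k ∈ I} V` are matrices indexed by `I → ι`. -/

section Legs

variable {ι : Type*} [Fintype ι] [DecidableEq ι]
variable {I : Type*} [Fintype I] [DecidableEq I]

/-- `Y_i`: the operator acting as `Y` in the tensor factor `i` and trivially in the others. -/
def leg (i : I) (Y : Matrix ι ι ℂ) : Matrix (I → ι) (I → ι) ℂ :=
  fun a b => if ∀ k, k ≠ i → a k = b k then Y (a i) (b i) else 0

/-- `X_{ij}` for `i ≠ j`: the operator acting as `X` in the tensor factors `i` (first factor of
`X`) and `j` (second factor of `X`), and trivially in the others. -/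
def leg₂ (i j : I) (X : Matrix (ι × ι) (ι × ι) ℂ) : Matrix (I → ι) (I → ι) ℂ :=
  fun a b => if ∀ k, k ≠ i → k ≠ j → a k = b k then X (a i, a j) (b i, b j) else 0

/-- Partial trace over the tensor factor `0` of `V ⊗ V^{⊗N}`. -/
def trZero {N : ℕ} (Z : Matrix (Fin (N + 1) → ι) (Fin (N + 1) → ι) ℂ) :
    Matrix (Fin N → ι) (Fin N → ι) ℂ :=
  fun a b => ∑ c : ι, Z (Fin.cons c a) (Fin.cons c b)

/-- Partial trace of an operator on `V ⊗ V` over the first factor. -/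
def trFst (Z : Matrix (ι × ι) (ι × ι) ℂ) : Matrix ι ι ℂ :=
  fun a b => ∑ c : ι, Z (c, a) (c, b)

/-- Partial transpose `X^{t_1}` of an operator on `V ⊗ V` with respect to the first factor. -/
def transposeFst (X : Matrix (ι × ι) (ι × ι) ℂ) : Matrix (ι × ι) (ι × ι) ℂ :=
  fun a b => X (b.1, a.2) (a.1, b.2)

/-- The flip `P (v ⊗ v') = v' ⊗ v` on `V ⊗ V`. -/
def flip : Matrix (ι × ι) (ι × ι) ℂ :=
  fun a b => if a.1 = b.2 ∧ a.2 = b.1 then 1 else 0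

end Legs

/-! ### R-matrices and K-matrices -/

/-- A matrix-valued function on `ℂ` all of whose entries are meromorphic on `ℂ`. -/
def MerMatrix {α : Type*} (X : ℂ → Matrix α α ℂ) : Prop :=
  ∀ a b, MeromorphicOn (fun x => X x a b) Set.univ

/-- `X x` is invertible for generic `x`. -/
def GenericallyInvertible {α : Type*} [Fintype α] [DecidableEq α] (X : ℂ → Matrix α α ℂ) : Prop :=
  Generic Set.univ (fun x => IsUnit (X x))

section Equations

variable {ι : Type*} [Fintype ι] [DecidableEq ι]

/-- Yang–Baxter equation
`R₁₂(x/y) R₁₃(x) R₂₃(y) = R₂₃(y) R₁₃(x) R₁₂(x/y)` on `V ⊗ V ⊗ V`, for generic `x, y`. -/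
def YangBaxter (R : ℂ → Matrix (ι × ι) (ι × ι) ℂ) : Prop :=
  Generic torusPair (fun q : ℂ × ℂ =>
    leg₂ (0 : Fin 3) 1 (R (q.1 / q.2)) * leg₂ (0 : Fin 3) 2 (R q.1) * leg₂ (1 : Fin 3) 2 (R q.2) =
    leg₂ (1 : Fin 3) 2 (R q.2) * leg₂ (0 : Fin 3) 2 (R q.1) * leg₂ (0 : Fin 3) 1 (R (q.1 / q.2)))

/-- Regularity: `1` is in the domain of `R`, and `R(1)` is a nonzero multiple of the flip. -/
def Regular (R : ℂ → Matrix (ι × ι) (ι × ι) ℂ) : Prop :=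
  (∀ a b, AnalyticAt ℂ (fun x => R x a b) 1) ∧ ∃ ρ : ℂ, ρ ≠ 0 ∧ R 1 = ρ • flip

/-- Left reflection equation
`R₁₂(x/y) K₁(x) R₂₁(xy) K₂(y) = K₂(y) R₁₂(xy) K₁(x) R₂₁(x/y)` on `V ⊗ V`, for generic `x, y`. -/
def LeftReflection (R : ℂ → Matrix (ι × ι) (ι × ι) ℂ) (K : ℂ → Matrix ι ι ℂ) : Prop :=
  Generic torusPair (fun q : ℂ × ℂ =>
    leg₂ (0 : Fin 2) 1 (R (q.1 / q.2)) * leg (0 : Fin 2) (K q.1) *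
      leg₂ (1 : Fin 2) 0 (R (q.1 * q.2)) * leg (1 : Fin 2) (K q.2) =
    leg (1 : Fin 2) (K q.2) * leg₂ (0 : Fin 2) 1 (R (q.1 * q.2)) *
      leg (0 : Fin 2) (K q.1) * leg₂ (1 : Fin 2) 0 (R (q.1 / q.2)))

/-- Right reflection equation
`R₂₁(x/y) K₁(x) R₁₂(xy) K₂(y) = K₂(y) R₂₁(xy) K₁(x) R₁₂(x/y)` on `V ⊗ V`, for generic `x, y`. -/
def RightReflection (R : ℂ → Matrix (ι × ι) (ι × ι) ℂ) (K : ℂ → Matrix ι ι ℂ) : Prop :=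
  Generic torusPair (fun q : ℂ × ℂ =>
    leg₂ (1 : Fin 2) 0 (R (q.1 / q.2)) * leg (0 : Fin 2) (K q.1) *
      leg₂ (0 : Fin 2) 1 (R (q.1 * q.2)) * leg (1 : Fin 2) (K q.2) =
    leg (1 : Fin 2) (K q.2) * leg₂ (1 : Fin 2) 0 (R (q.1 * q.2)) *
      leg (0 : Fin 2) (K q.1) * leg₂ (0 : Fin 2) 1 (R (q.1 / q.2)))

/-- Boundary unitarity: `K(x) K(x⁻¹)` is a nonzero multiple of the identity, for generic `x`. -/
def BoundaryUnitary (K : ℂ → Matrix ι ι ℂ) : Prop :=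
  Generic {x : ℂ | x ≠ 0} (fun x => ∃ c : ℂ, c ≠ 0 ∧ K x * K x⁻¹ = c • (1 : Matrix ι ι ℂ))

/-- `R̃(x) = ((R(x)^{t_1})⁻¹)^{t_1}`. -/
def tilde (R : ℂ → Matrix (ι × ι) (ι × ι) ℂ) : ℂ → Matrix (ι × ι) (ι × ι) ℂ :=
  fun x => transposeFst (transposeFst (R x))⁻¹

/-- `φ_R(Y)₁(x) = Tr₀ Y₀(x) P₀₁ R₀₁(x²)`. -/
def phi (R : ℂ → Matrix (ι × ι) (ι × ι) ℂ) (Y : ℂ → Matrix ι ι ℂ) : ℂ → Matrix ι ι ℂ :=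
  fun x => trFst ((Y x ⊗ₖ (1 : Matrix ι ι ℂ)) * flip * R (x ^ 2))

/-- The inhomogeneous boundary transfer matrix on `V^{⊗N}`,
`𝒯(x; z) = Tr₀ K'₀(x) R₀₁(1/(x z₁))⁻¹ ⋯ R₀N(1/(x z_N))⁻¹ K⁻₀(x) R₀N(x/z_N) ⋯ R₀₁(x/z₁)`. -/
def transferMatrix {N : ℕ} (R : ℂ → Matrix (ι × ι) (ι × ι) ℂ) (K' Km : ℂ → Matrix ι ι ℂ)
    (x : ℂ) (z : Fin N → ℂ) : Matrix (Fin N → ι) (Fin N → ι) ℂ :=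
  trZero
    (leg (0 : Fin (N + 1)) (K' x) *
      ((List.finRange N).map
        (fun j => leg₂ (0 : Fin (N + 1)) j.succ (R (1 / (x * z j)))⁻¹)).prod *
      leg (0 : Fin (N + 1)) (Km x) *
      ((List.finRange N).reverse.map
        (fun j => leg₂ (0 : Fin (N + 1)) j.succ (R (x / z j)))).prod)

/-- The bqKZ transport matrix on `V^{⊗N}`,
`𝒜_i(z; p) = R_{i,i-1}(p z_i/z_{i-1}) ⋯ R_{i,1}(p z_i/z_1) K⁺_i(p^{1/2} z_i)`
`· R_{1,i}(z_1 z_i) ⋯ R_{i-1,i}(z_{i-1} z_i) R_{i+1,i}(z_{i+1} z_i) ⋯ R_{N,i}(z_N z_i)`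
`· K⁻_i(z_i) R_{N,i}(z_N/z_i)⁻¹ ⋯ R_{i+1,i}(z_{i+1}/z_i)⁻¹`. -/
def transportMatrix {N : ℕ} (R : ℂ → Matrix (ι × ι) (ι × ι) ℂ) (Kp Km : ℂ → Matrix ι ι ℂ)
    (i : Fin N) (z : Fin N → ℂ) (p : ℂ) : Matrix (Fin N → ι) (Fin N → ι) ℂ :=
  (((List.finRange N).filter (fun j => j < i)).reverse.map
      (fun j => leg₂ i j (R (p * z i / z j)))).prod *
    leg i (Kp (p ^ (1 / 2 : ℂ) * z i)) *
    (((List.finRange N).filter (fun j => j < i)).map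
      (fun j => leg₂ j i (R (z j * z i)))).prod *
    (((List.finRange N).filter (fun j => i < j)).map
      (fun j => leg₂ j i (R (z j * z i)))).prod *
    leg i (Km (z i)) *
    (((List.finRange N).filter (fun j => i < j)).reverse.map
      (fun j => leg₂ j i (R (z j / z i))⁻¹)).prod

end Equations

end

end BoundaryQKZ

/-! Everything rests on the values of `x` at which one R-matrix in the transfer matrix becomes a
flip.

Unitarity is not assumed but follows from the Yang–Baxter equation and regularity. With the first
spectral parameter equal to 1, the equation says that `R(y⁻¹)R₂₁(y)` in factors 1, 2 equals
`R(y)R₂₁(y⁻¹)` in factors 2, 3. Using this also for `y⁻¹` makes both products scalar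
(`generic_isUnitaryAt`), and generic invertibility of `R` makes the scalar nonzero. Hence, up to
meromorphic factors, inverses of R-matrices may be replaced by R-matrices with swapped factors and
inverted argument.

At `x = z_i` the factor `R_{0i}(x/z_i)` is a multiple of the flip `P_{0i}`. Moving the flip through
the word turns index 0 into `i`, and Yang–Baxter moves the sites before `i` past `R_{i0}(z_i²)`.
Factor 0 then survives only in `Tr₀ K'₀ P_{0i} R_{0i}(z_i²)`, which is `K⁺_i(z_i)` by the choice of
`K'` (`trFst_phi_tilde`). The result is a multiple of `boundaryChain`, and so is `𝒜_i(z;1)`. At `x =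
z_i⁻¹` the flip sits in the other half of the word, and the same argument gives a multiple of
`inverseBoundaryChain`. By unitarity and boundary unitarity the two chains multiply to a nonzero
scalar.

For commutativity it therefore suffices that the chains of two sites `i < j` commute
(`commute_chainOperator`). The sites before `i` dress `K⁺` and the sites after `j` dress `K⁻`;
dressing preserves the reflection equations. What remains is an identity between words,
`commute_of_dressed_reflections`.

Genericity is carried along by pulling thin sets back under open analytic maps such as `z ↦ (z_a
z_c, z_c/z_b)`, so that all identities hold simultaneously at a generic `z`
(`generic_isRegularPoint`). -/

namespace BoundaryQKZ

set_option linter.unusedSectionVars false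

/-! ### Thin sets, meromorphic factors and their pullbacks. -/

section Genericity

variable {E : Type*} [NormedAddCommGroup E] [NormedSpace ℂ E]
variable {F : Type*} [NormedAddCommGroup F] [NormedSpace ℂ F]
variable {G : Type*} [NormedAddCommGroup G] [NormedSpace ℂ G]

/-- Germs of analytic functions of several variables form a domain. -/
theorem frequently_mul_ne_zero {g h : E → ℂ} {w : E} (hg : AnalyticAt ℂ g w)
    (hh : AnalyticAt ℂ h w) (hg0 : ∃ᶠ z in 𝓝 w, g z ≠ 0) (hh0 : ∃ᶠ z in 𝓝 w, h z ≠ 0) :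
    ∃ᶠ z in 𝓝 w, g z * h z ≠ 0 := by
  intro H
  obtain ⟨r, hr, hB⟩ := Metric.eventually_nhds_iff_ball.mp
    ((hg.eventually_analyticAt.and hh.eventually_analyticAt).and H)
  have hball : Metric.ball w r ∈ 𝓝 w := Metric.ball_mem_nhds w hr
  obtain ⟨p, hp, hpB⟩ := (hg0.and_eventually hball).exists
  -- Near a point where `g` is nonzero the vanishing product forces `h = 0`; the identity theorem
  -- then spreads this over the whole ball.
  have h0 : h =ᶠ[𝓝 p] 0 := by
    filter_upwards [(hB p hpB).1.1.continuousAt.eventually_ne hp,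
      Metric.isOpen_ball.mem_nhds hpB] with z hz hzB
    have := (hB z hzB).2
    simp only [ne_eq, mul_eq_zero, not_not] at this
    exact this.resolve_left hz
  have hA : AnalyticOnNhd ℂ h (Metric.ball w r) := fun z hz => (hB z hz).1.2
  have hz := hA.eqOn_zero_of_preconnected_of_eventuallyEq_zero
    (convex_ball w r).isPreconnected hpB h0
  obtain ⟨q, hq, hqB⟩ := (hh0.and_eventually hball).exists
  exact hq (hz hqB)

theorem Generic.mono {U : Set E} {P Q : E → Prop} (h : Generic U P) (hPQ : ∀ z, P z → Q z) :
    Generic U Q := by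
  intro w hw
  obtain ⟨g, h1, h2, h3⟩ := h w hw
  exact ⟨g, h1, h2, h3.mono fun z hz h0 => hPQ z (hz h0)⟩

theorem Generic.mono_set {U V : Set E} {P : E → Prop} (h : Generic V P) (hUV : U ⊆ V) :
    Generic U P := fun w hw => h w (hUV hw)

theorem Generic.of_forall_mem {U : Set E} {P : E → Prop} (hU : IsOpen U) (h : ∀ z ∈ U, P z) :
    Generic U P := fun _ hw =>
  ⟨fun _ => 1, analyticAt_const, Eventually.frequently (Eventually.of_forall fun _ => one_ne_zero),
    (hU.eventually_mem hw).mono fun z hz _ => h z hz⟩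

theorem Generic.and {U : Set E} {P Q : E → Prop} (hP : Generic U P) (hQ : Generic U Q) :
    Generic U (fun z => P z ∧ Q z) := by
  intro w hw
  obtain ⟨g, g1, g2, g3⟩ := hP w hw
  obtain ⟨h, h1, h2, h3⟩ := hQ w hw
  refine ⟨fun z => g z * h z, g1.mul h1, frequently_mul_ne_zero g1 h1 g2 h2, ?_⟩
  filter_upwards [g3, h3] with z hg hh h0
  exact ⟨hg (left_ne_zero_of_mul h0), hh (right_ne_zero_of_mul h0)⟩

theorem Generic.of_forall {U : Set E} {P : E → Prop} (h : ∀ z, P z) : Generic U P := fun _ _ =>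
  ⟨fun _ => 1, analyticAt_const, Eventually.frequently (Eventually.of_forall fun _ => one_ne_zero),
    Eventually.of_forall fun z _ => h z⟩

theorem Generic.forall_finite {U : Set E} {κ : Type*} [Finite κ] {P : κ → E → Prop}
    (h : ∀ k, Generic U (P k)) : Generic U (fun z => ∀ k, P k z) := by
  classical
  cases nonempty_fintype κ
  suffices ∀ s : Finset κ, Generic U (fun z => ∀ k ∈ s, P k z) from
    (this Finset.univ).mono fun z hz k => hz k (Finset.mem_univ k)
  intro s
  induction s using Finset.induction_on with
  | empty => exact Generic.of_forall (by simp)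
  | insert a s _ ih =>
    refine ((h a).and ih).mono fun z hz k hk => ?_
    rcases Finset.mem_insert.mp hk with rfl | hk
    · exact hz.1
    · exact hz.2 k hk

theorem Generic.imp {U : Set E} {p : Prop} {P : E → Prop} (h : p → Generic U P) :
    Generic U (fun z => p → P z) := by
  by_cases hp : p
  · exact (h hp).mono fun z hz _ => hz
  · exact Generic.of_forall fun z h' => absurd h' hp

theorem Generic.frequently {U : Set E} {P : E → Prop} (h : Generic U P) {w : E} (hw : w ∈ U) :
    ∃ᶠ z in 𝓝 w, P z := by
  obtain ⟨g, -, h2, h3⟩ := h w hw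
  exact (h2.and_eventually h3).mono fun z hz => hz.2 hz.1

/-- An identity which holds generically holds at every point of continuity. -/
theorem Generic.eq_of_continuousAt {X : Type*} [TopologicalSpace X] [T2Space X] {U : Set E}
    {f g : E → X} (h : Generic U fun z => f z = g z) {w : E} (hw : w ∈ U)
    (hf : ContinuousAt f w) (hg : ContinuousAt g w) : f w = g w :=
  tendsto_nhds_unique_of_frequently_eq hf hg (h.frequently hw)

theorem Generic.of_eventually_punctured {U : Set ℂ} {P : ℂ → Prop}
    (h : ∀ w ∈ U, ∀ᶠ x in 𝓝[≠] w, P x) : Generic U P := by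
  intro w hw
  refine ⟨fun x => x - w, by fun_prop, ?_, ?_⟩
  · have : ∃ᶠ x in 𝓝[≠] w, x ∈ ({w}ᶜ : Set ℂ) :=
      (eventually_mem_nhdsWithin).frequently
    exact (this.filter_mono nhdsWithin_le_nhds).mono fun x hx => sub_ne_zero.mpr hx
  · filter_upwards [eventually_nhdsWithin_iff.mp (h w hw)] with x hx h0
    exact hx (sub_ne_zero.mp h0)

/-- An analytic map between `U` and `V` which is open at every point of `U`. -/
def IsOpenAnalytic (U : Set E) (V : Set F) (φ : E → F) : Prop :=
  ∀ w ∈ U, φ w ∈ V ∧ AnalyticAt ℂ φ w ∧ 𝓝 (φ w) ≤ map φ (𝓝 w)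

theorem IsOpenAnalytic.comp {U : Set E} {V : Set F} {W : Set G} {φ : E → F} {ψ : F → G}
    (hψ : IsOpenAnalytic V W ψ) (hφ : IsOpenAnalytic U V φ) :
    IsOpenAnalytic U W (fun z => ψ (φ z)) := by
  intro w hw
  obtain ⟨h1, h2, h3⟩ := hφ w hw
  obtain ⟨k1, k2, k3⟩ := hψ _ h1
  refine ⟨k1, k2.comp h2, k3.trans ?_⟩
  have := Filter.map_mono (m := ψ) h3
  rwa [Filter.map_map] at this

/-- A continuous local section through `w` yields openness at `w`; most of the monomial maps used
below have an explicit one. -/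
theorem nhds_le_map_of_section {X Y : Type*} [TopologicalSpace X] [TopologicalSpace Y]
    {φ : X → Y} (σ : Y → X) {w : X} (hσ : ContinuousAt σ (φ w)) (hw : σ (φ w) = w)
    (h : ∀ᶠ q in 𝓝 (φ w), φ (σ q) = q) : 𝓝 (φ w) ≤ map φ (𝓝 w) := by
  have h1 : map σ (𝓝 (φ w)) ≤ 𝓝 w := by
    have := hσ.tendsto
    rwa [hw] at this
  have h2 := Filter.map_mono (m := φ) h1
  rw [Filter.map_map] at h2
  refine le_trans (le_of_eq ?_) h2
  conv_lhs => rw [← Filter.map_id (f := 𝓝 (φ w))]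
  exact (Filter.map_congr h).symm

/-- Openness of `φ` is what prevents `g ∘ φ` from vanishing identically near `w`. -/
theorem Generic.comp {U : Set E} {V : Set F} {φ : E → F} {P : F → Prop} (hP : Generic V P)
    (hφ : IsOpenAnalytic U V φ) : Generic U (fun z => P (φ z)) := by
  intro w hw
  obtain ⟨h1, h2, h3⟩ := hφ w hw
  obtain ⟨g, g1, g2, g3⟩ := hP _ h1
  refine ⟨fun z => g (φ z), g1.comp h2, ?_, h2.continuousAt.eventually g3⟩
  exact Filter.frequently_map.mp (g2.filter_mono h3)

theorem IsMeromorphicOn.comp {U : Set E} {V : Set F} {φ : E → F} {m : F → ℂ}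
    (hm : IsMeromorphicOn V m) (hφ : IsOpenAnalytic U V φ) :
    IsMeromorphicOn U (fun z => m (φ z)) := by
  intro w hw
  obtain ⟨h1, h2, h3⟩ := hφ w hw
  obtain ⟨g, h, g1, h1', h0, hgh⟩ := hm _ h1
  exact ⟨fun z => g (φ z), fun z => h (φ z), g1.comp h2, h1'.comp h2,
    Filter.frequently_map.mp (h0.filter_mono h3), h2.continuousAt.eventually hgh⟩

theorem IsMeromorphicOn.of_meromorphicAt {U : Set ℂ} {f : ℂ → ℂ}
    (hf : ∀ x ∈ U, MeromorphicAt f x) : IsMeromorphicOn U f := by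
  intro w hw
  obtain ⟨n, hn⟩ := hf w hw
  refine ⟨fun x => (x - w) * ((x - w) ^ n • f x), fun x => (x - w) ^ (n + 1),
    (by fun_prop : AnalyticAt ℂ (fun x => x - w) w).mul hn, by fun_prop, ?_,
    Eventually.of_forall fun x hx => ?_⟩
  · have : ∃ᶠ x in 𝓝[≠] w, x ∈ ({w}ᶜ : Set ℂ) := (eventually_mem_nhdsWithin).frequently
    exact (this.filter_mono nhdsWithin_le_nhds).mono fun x hx =>
      pow_ne_zero _ (sub_ne_zero.mpr hx)
  · rw [eq_div_iff hx]
    simp only [smul_eq_mul]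
    ring

/-- `m` is meromorphic on `U` and generically nonzero. -/
structure IsMeromorphicUnit (U : Set E) (m : E → ℂ) : Prop where
  meromorphic : IsMeromorphicOn U m
  ne_zero : Generic U (fun z => m z ≠ 0)

namespace IsMeromorphicUnit

variable {U : Set E} {m n : E → ℂ}

theorem const {c : ℂ} (hc : c ≠ 0) : IsMeromorphicUnit U (fun _ => c) where
  meromorphic _ _ := ⟨fun _ => c, fun _ => 1, analyticAt_const, analyticAt_const,
    Eventually.frequently (Eventually.of_forall fun _ => one_ne_zero),
    Eventually.of_forall fun _ _ => by simp⟩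
  ne_zero := Generic.of_forall fun _ => hc

theorem mul (hm : IsMeromorphicUnit U m) (hn : IsMeromorphicUnit U n) :
    IsMeromorphicUnit U (fun z => m z * n z) where
  meromorphic w hw := by
    obtain ⟨g, h, g1, h1, h0, hgh⟩ := hm.meromorphic w hw
    obtain ⟨g', h', g1', h1', h0', hgh'⟩ := hn.meromorphic w hw
    refine ⟨fun z => g z * g' z, fun z => h z * h' z, g1.mul g1', h1.mul h1',
      frequently_mul_ne_zero h1 h1' h0 h0', ?_⟩
    filter_upwards [hgh, hgh'] with z hz hz' hne
    rw [hz (left_ne_zero_of_mul hne), hz' (right_ne_zero_of_mul hne), div_mul_div_comm]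
  ne_zero := (hm.ne_zero.and hn.ne_zero).mono fun _ h => mul_ne_zero h.1 h.2

theorem inv (hm : IsMeromorphicUnit U m) : IsMeromorphicUnit U (fun z => (m z)⁻¹) where
  meromorphic w hw := by
    obtain ⟨g, h, g1, h1, h0, hgh⟩ := hm.meromorphic w hw
    obtain ⟨k, k1, k0, hk⟩ := hm.ne_zero w hw
    -- The numerator is not identically zero: where both `k` and `h` are nonzero, `m = g / h` is
    -- nonzero.
    have hg0 : ∃ᶠ z in 𝓝 w, g z ≠ 0 := by
      refine ((frequently_mul_ne_zero k1 h1 k0 h0).and_eventually (hk.and hgh)).mono ?_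
      rintro z ⟨hz, hz1, hz2⟩ hg
      apply hz1 (left_ne_zero_of_mul hz)
      rw [hz2 (right_ne_zero_of_mul hz), hg, zero_div]
    -- The inverse is written `h² / (g h)` rather than `h / g`, because `m` is known to equal `g /
    -- h` only where `h ≠ 0`.
    refine ⟨fun z => h z * h z, fun z => g z * h z, h1.mul h1, g1.mul h1,
      frequently_mul_ne_zero g1 h1 hg0 h0, ?_⟩
    filter_upwards [hgh] with z hz hne
    have := right_ne_zero_of_mul hne
    have := left_ne_zero_of_mul hne
    rw [hz ‹_›]
    field_simp
  ne_zero := hm.ne_zero.mono fun _ h => inv_ne_zero h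

theorem list_prod {κ : Type*} {f : κ → E → ℂ} (L : List κ)
    (h : ∀ j ∈ L, IsMeromorphicUnit U (f j)) :
    IsMeromorphicUnit U (fun z => (L.map fun j => f j z).prod) := by
  induction L with
  | nil => simpa using const one_ne_zero
  | cons j L ih =>
    simp only [List.map_cons, List.prod_cons]
    exact (h j (by simp)).mul (ih fun k hk => h k (by simp [hk]))

theorem comp {V : Set F} {φ : F → E} (hm : IsMeromorphicUnit U m) (hφ : IsOpenAnalytic V U φ) :
    IsMeromorphicUnit V (fun z => m (φ z)) where
  meromorphic := hm.meromorphic.comp hφ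
  ne_zero := hm.ne_zero.comp hφ

end IsMeromorphicUnit

end Genericity

/-! ### Open monomial maps from the torus to spectral parameters. -/

section Torus

variable {N : ℕ}

theorem isOpen_torus : IsOpen (torus N) := by
  have : torus N = ⋂ i, {z : Fin N → ℂ | z i ≠ 0} := by
    ext z
    simp [torus]
  rw [this]
  exact isOpen_iInter_of_finite fun i => isOpen_ne_fun (continuous_apply i) continuous_const

theorem isOpenAnalytic_pow_two : IsOpenAnalytic {x : ℂ | x ≠ 0} {x : ℂ | x ≠ 0} (fun x => x ^ 2) := by
  intro w hw
  refine ⟨pow_ne_zero 2 hw, by fun_prop, ?_⟩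
  have := (hasStrictDerivAt_pow 2 w).map_nhds_eq (by simpa using hw)
  exact this.ge

theorem isOpenAnalytic_inv : IsOpenAnalytic {x : ℂ | x ≠ 0} {x : ℂ | x ≠ 0} (fun x => x⁻¹) := by
  intro w hw
  refine ⟨inv_ne_zero hw, analyticAt_inv hw, ?_⟩
  exact nhds_le_map_of_section (fun x => x⁻¹) (continuousAt_inv₀ (inv_ne_zero hw)) (inv_inv w)
    (Eventually.of_forall inv_inv)

theorem isOpenAnalytic_mul :
    IsOpenAnalytic torusPair {x : ℂ | x ≠ 0} (fun q : ℂ × ℂ => q.1 * q.2) := by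
  rintro ⟨x, y⟩ ⟨hx, hy⟩
  refine ⟨mul_ne_zero hx hy, by fun_prop, ?_⟩
  exact nhds_le_map_of_section (fun t => (t / y, y)) (by fun_prop)
    (by simp [mul_div_cancel_right₀ _ (show y ≠ 0 from hy)])
    (Eventually.of_forall fun t => div_mul_cancel₀ t hy)

theorem isOpenAnalytic_div :
    IsOpenAnalytic torusPair {x : ℂ | x ≠ 0} (fun q : ℂ × ℂ => q.1 / q.2) := by
  rintro ⟨x, y⟩ ⟨hx, hy⟩
  refine ⟨div_ne_zero hx hy, analyticAt_fst.div analyticAt_snd hy, ?_⟩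
  exact nhds_le_map_of_section (fun t => (t * y, y)) (by fun_prop)
    (by simp [div_mul_cancel₀ _ (show y ≠ 0 from hy)])
    (Eventually.of_forall fun t => mul_div_cancel_right₀ t hy)

theorem isOpenAnalytic_inv_fst :
    IsOpenAnalytic torusPair torusPair (fun q : ℂ × ℂ => (q.1⁻¹, q.2)) := by
  rintro ⟨x, y⟩ ⟨hx, hy⟩
  refine ⟨⟨inv_ne_zero hx, hy⟩, (analyticAt_fst.inv hx).prod analyticAt_snd, ?_⟩
  refine nhds_le_map_of_section (fun q => (q.1⁻¹, q.2)) ?_ (by simp)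
    (Eventually.of_forall fun q => by simp)
  exact (continuousAt_fst.inv₀ (inv_ne_zero hx)).prodMk continuousAt_snd

theorem isOpenAnalytic_sq_mul :
    IsOpenAnalytic torusPair torusPair (fun q : ℂ × ℂ => (q.1 ^ 2, q.1 * q.2)) := by
  rintro ⟨x, y⟩ ⟨hx, hy⟩
  have hx : x ≠ 0 := hx
  refine ⟨⟨pow_ne_zero 2 hx, mul_ne_zero hx hy⟩,
    (analyticAt_fst.pow 2).prod (analyticAt_fst.mul analyticAt_snd), ?_⟩
  -- The section needs the branch of the square root of `q.1` that equals `x` at `x ^ 2`. The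
  -- principal power is applied to `q.1 / x ^ 2`, which is near 1 and so away from the cut.
  have hc : ContinuousAt (fun q : ℂ × ℂ => x * (q.1 / x ^ 2) ^ (1 / 2 : ℂ)) (x ^ 2, x * y) := by
    refine continuousAt_const.mul (ContinuousAt.cpow (by fun_prop) continuousAt_const ?_)
    simp [hx]
  refine nhds_le_map_of_section (fun q => (x * (q.1 / x ^ 2) ^ (1 / 2 : ℂ),
    q.2 / (x * (q.1 / x ^ 2) ^ (1 / 2 : ℂ)))) ?_ (by simp [hx]) ?_
  · exact hc.prodMk (continuousAt_snd.div hc (by simp [hx]))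
  · have h1 : ∀ᶠ q : ℂ × ℂ in 𝓝 (x ^ 2, x * y), q.1 ≠ 0 :=
      continuousAt_fst.eventually_ne (pow_ne_zero 2 hx)
    filter_upwards [h1] with q hq
    have h2 : ((q.1 / x ^ 2) ^ (1 / 2 : ℂ)) ^ 2 = q.1 / x ^ 2 := by
      rw [← Complex.cpow_nat_mul]
      simp
    have h3 : (q.1 / x ^ 2) ^ (1 / 2 : ℂ) ≠ 0 := by
      intro h
      rw [h] at h2
      have : q.1 / x ^ 2 ≠ 0 := div_ne_zero hq (pow_ne_zero 2 hx)
      exact this (by rw [← h2]; simp)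
    ext
    · simp only [mul_pow, h2]
      field_simp
    · exact mul_div_cancel₀ _ (mul_ne_zero hx h3)

theorem isOpenAnalytic_eval (i : Fin N) :
    IsOpenAnalytic (torus N) {x : ℂ | x ≠ 0} (fun z => z i) := by
  intro w hw
  refine ⟨hw i, (ContinuousLinearMap.proj (R := ℂ) i).analyticAt w, ?_⟩
  exact nhds_le_map_of_section (fun t => Function.update w i t)
    (continuousAt_const.update i continuousAt_id) (by simp)
    (Eventually.of_forall fun t => by simp)

theorem analyticAt_eval (i : Fin N) (w : Fin N → ℂ) : AnalyticAt ℂ (fun z : Fin N → ℂ => z i) w :=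
  (ContinuousLinearMap.proj (R := ℂ) i).analyticAt w

theorem isOpenAnalytic_eval_pair {i j : Fin N} (hij : i ≠ j) :
    IsOpenAnalytic (torus N) torusPair (fun z => (z i, z j)) := by
  intro w hw
  refine ⟨⟨hw i, hw j⟩, (analyticAt_eval i w).prod (analyticAt_eval j w), ?_⟩
  exact nhds_le_map_of_section (fun q => Function.update (Function.update w i q.1) j q.2)
    ((continuousAt_const.update i continuousAt_fst).update j continuousAt_snd) (by simp)
    (Eventually.of_forall fun q => by simp [Function.update_of_ne hij])

theorem isOpenAnalytic_div_div {a b c : Fin N} (hab : a ≠ b) (hac : a ≠ c) (hbc : b ≠ c) :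
    IsOpenAnalytic (torus N) torusPair (fun z => (z a / z c, z b / z c)) := by
  intro w hw
  have hc : w c ≠ 0 := hw c
  refine ⟨⟨div_ne_zero (hw a) hc, div_ne_zero (hw b) hc⟩,
    ((analyticAt_eval a w).div (analyticAt_eval c w) hc).prod
      ((analyticAt_eval b w).div (analyticAt_eval c w) hc), ?_⟩
  refine nhds_le_map_of_section
    (fun q => Function.update (Function.update w a (q.1 * w c)) b (q.2 * w c))
    ((continuousAt_const.update a (by fun_prop)).update b (by fun_prop)) (by simp [hc])
    (Eventually.of_forall fun q => ?_)
  simp [Function.update_of_ne hab, Function.update_of_ne hac.symm, Function.update_of_ne hbc.symm,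
    hc]

theorem isOpenAnalytic_mul_mul {a b c : Fin N} (hab : a ≠ b) (hac : a ≠ c) (hbc : b ≠ c) :
    IsOpenAnalytic (torus N) torusPair (fun z => (z a * z c, z b * z c)) := by
  intro w hw
  have hc : w c ≠ 0 := hw c
  refine ⟨⟨mul_ne_zero (hw a) hc, mul_ne_zero (hw b) hc⟩,
    ((analyticAt_eval a w).mul (analyticAt_eval c w)).prod
      ((analyticAt_eval b w).mul (analyticAt_eval c w)), ?_⟩
  refine nhds_le_map_of_section
    (fun q => Function.update (Function.update w a (q.1 / w c)) b (q.2 / w c))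
    ((continuousAt_const.update a (by fun_prop)).update b (by fun_prop)) (by simp [hc])
    (Eventually.of_forall fun q => ?_)
  simp [Function.update_of_ne hab, Function.update_of_ne hac.symm, Function.update_of_ne hbc.symm,
    hc]

theorem isOpenAnalytic_mul_div {a b c : Fin N} (hab : a ≠ b) (hac : a ≠ c) (hbc : b ≠ c) :
    IsOpenAnalytic (torus N) torusPair (fun z => (z a * z c, z c / z b)) := by
  intro w hw
  have hc : w c ≠ 0 := hw c
  have hb : w b ≠ 0 := hw b
  refine ⟨⟨mul_ne_zero (hw a) hc, div_ne_zero hc hb⟩,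
    ((analyticAt_eval a w).mul (analyticAt_eval c w)).prod
      ((analyticAt_eval c w).div (analyticAt_eval b w) hb), ?_⟩
  refine nhds_le_map_of_section
    (fun q => Function.update (Function.update w a (q.1 / w c)) b (w c / q.2)) ?_ ?_ ?_
  · refine (continuousAt_const.update a (by fun_prop)).update b ?_
    exact continuousAt_const.div continuousAt_snd (div_ne_zero hc hb)
  · simp [hc]
  · refine Eventually.of_forall fun q => ?_
    simp [Function.update_of_ne hab, Function.update_of_ne hac.symm,
      Function.update_of_ne hbc.symm, hc]

end Torus

/-! ### Operators acting in selected tensor factors. -/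

section Embedding

variable {ι : Type*} [Fintype ι] [DecidableEq ι]
variable {I : Type*} [Fintype I] [DecidableEq I]
variable {J : Type*} [Fintype J] [DecidableEq J]
variable {H : Type*} [Fintype H] [DecidableEq H]

/-- An operator on `V^{⊗J}` acting in the tensor factors `f j` of `V^{⊗I}`. -/
def embed (f : J → I) (X : Matrix (J → ι) (J → ι) ℂ) : Matrix (I → ι) (I → ι) ℂ :=
  fun a b => if ∀ k, (∀ j, f j ≠ k) → a k = b k then X (a ∘ f) (b ∘ f) else 0

theorem embed_one (f : J → I) : embed f (1 : Matrix (J → ι) (J → ι) ℂ) = 1 := by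
  ext a b
  by_cases hab : a = b
  · subst hab
    simp [embed]
  · simp only [embed, Matrix.one_apply_ne hab]
    split_ifs with h
    · refine Matrix.one_apply_ne fun hf => hab (funext fun k => ?_)
      by_cases hk : ∃ j, f j = k
      · obtain ⟨j, rfl⟩ := hk
        exact congrFun hf j
      · exact h k (not_exists.mp hk)
    · rfl

/-- An intermediate index contributes only if it agrees with `a` outside the image of `f`; such
indices are the extensions of the `d : J → ι`, so the sum collapses to the matrix product over `J →
ι`. -/
theorem embed_mul {f : J → I} (hf : Function.Injective f) (X Y : Matrix (J → ι) (J → ι) ℂ) :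
    embed f (X * Y) = embed f X * embed f Y := by
  ext a b
  simp only [embed, Matrix.mul_apply]
  split_ifs with h
  · refine Finset.sum_of_injOn (fun d => Function.extend f d a) ?_ (by simp) ?_ ?_
    · intro d _ d' _ hd
      ext j
      have := congrFun hd (f j)
      simpa [hf.extend_apply] using this
    · intro c _ hc
      rw [if_neg, zero_mul]
      intro hac
      refine hc ⟨c ∘ f, by simp, funext fun k => ?_⟩
      by_cases hk : ∃ j, f j = k
      · obtain ⟨j, rfl⟩ := hk
        simp [hf.extend_apply]
      · simp only [Function.extend_apply' _ _ _ hk]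
        exact hac k (not_exists.mp hk)
    · intro d _
      have h1 : ∀ k, (∀ j, f j ≠ k) → Function.extend f d a k = a k := fun k hk =>
        Function.extend_apply' _ _ _ (not_exists.mpr hk)
      have h2 : Function.extend f d a ∘ f = d := funext fun j => hf.extend_apply _ _ _
      rw [if_pos fun k hk => (h1 k hk).symm, if_pos fun k hk => (h1 k hk).trans (h k hk), h2]
  · refine (Finset.sum_eq_zero fun c _ => ?_).symm
    split_ifs with h1 h2
    · exact absurd (fun k hk => (h1 k hk).trans (h2 k hk)) h
    all_goals simp

theorem embed_embed {f : J → I} (hf : Function.Injective f) (g : H → J)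
    (X : Matrix (H → ι) (H → ι) ℂ) : embed f (embed g X) = embed (f ∘ g) X := by
  ext a b
  simp only [embed, ← ite_and, Function.comp_assoc]
  refine if_congr ⟨?_, fun h => ⟨fun k hk => h k fun j => hk _, fun j hj => h _ fun l hl => ?_⟩⟩
    rfl rfl
  · rintro ⟨h1, h2⟩ k hk
    by_cases hj : ∃ j, f j = k
    · obtain ⟨j, rfl⟩ := hj
      exact h2 j fun l hl => hk l (congrArg f hl)
    · exact h1 k (not_exists.mp hj)
  · exact hj l (hf hl)

/-- For disjoint images exactly one intermediate index can contribute: it equals `b` on the image of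
`f` and `a` elsewhere. The resulting formula is symmetric in the two operators, which is the reason
they commute. -/
theorem embed_mul_embed_apply {f : J → I} {g : H → I} (hfg : ∀ j l, f j ≠ g l)
    (X : Matrix (J → ι) (J → ι) ℂ) (Y : Matrix (H → ι) (H → ι) ℂ) (a b : I → ι) :
    (embed f X * embed g Y) a b =
      if ∀ k, (∀ j, f j ≠ k) → (∀ l, g l ≠ k) → a k = b k then
        X (a ∘ f) (b ∘ f) * Y (a ∘ g) (b ∘ g) else 0 := by
  simp only [embed, Matrix.mul_apply]
  rw [Finset.sum_eq_single (fun k => if ∃ j, f j = k then b k else a k)]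
  · have h1 : (fun k => if ∃ j, f j = k then b k else a k) ∘ f = b ∘ f := by
      ext j
      simp
    have h2 : (fun k => if ∃ j, f j = k then b k else a k) ∘ g = a ∘ g := by
      ext l
      simp [hfg]
    rw [h1, h2, if_pos]
    · by_cases h : ∀ k, (∀ j, f j ≠ k) → (∀ l, g l ≠ k) → a k = b k
      · rw [if_pos h, if_pos]
        intro k hk
        by_cases hj : ∃ j, f j = k
        · simp only [if_pos hj]
        · simp only [if_neg hj]
          exact h k (not_exists.mp hj) hk
      · rw [if_neg h, if_neg, mul_zero]
        refine fun h' => h fun k hk hk' => ?_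
        have := h' k hk'
        simpa only [if_neg (not_exists.mpr hk)] using this
    · intro k hk
      simp only [if_neg (not_exists.mpr hk)]
  · intro c _ hc
    split_ifs with h1 h2
    · refine absurd (funext fun k => ?_) hc
      by_cases hj : ∃ j, f j = k
      · rw [if_pos hj]
        obtain ⟨j, rfl⟩ := hj
        exact h2 _ fun l hl => hfg j l hl.symm
      · rw [if_neg hj]
        exact (h1 k (not_exists.mp hj)).symm
    all_goals simp
  · simp

theorem embed_commute {f : J → I} {g : H → I} (hfg : ∀ j l, f j ≠ g l)
    (X : Matrix (J → ι) (J → ι) ℂ) (Y : Matrix (H → ι) (H → ι) ℂ) :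
    Commute (embed f X) (embed g Y) := by
  ext a b
  rw [embed_mul_embed_apply hfg, embed_mul_embed_apply fun j l => (hfg l j).symm]
  refine if_congr ⟨fun h k h1 h2 => h k h2 h1, fun h k h1 h2 => h k h2 h1⟩ (mul_comm _ _) rfl

theorem leg_eq_embed (i : I) (Y : Matrix ι ι ℂ) :
    leg i Y = embed (fun _ : Fin 1 => i) (leg 0 Y) := by
  ext a b
  simp [leg, embed, eq_comm]

theorem leg₂_eq_embed (i j : I) (X : Matrix (ι × ι) (ι × ι) ℂ) :
    leg₂ i j X = embed ![i, j] (leg₂ 0 1 X) := by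
  ext a b
  simp [leg₂, embed, Fin.forall_fin_two, eq_comm]

theorem embed_leg {f : J → I} (hf : Function.Injective f) (i : J) (Y : Matrix ι ι ℂ) :
    embed f (leg i Y) = leg (f i) Y := by
  rw [leg_eq_embed i, embed_embed hf, leg_eq_embed (f i)]
  rfl

theorem embed_leg₂ {f : J → I} (hf : Function.Injective f) (i j : J)
    (X : Matrix (ι × ι) (ι × ι) ℂ) : embed f (leg₂ i j X) = leg₂ (f i) (f j) X := by
  rw [leg₂_eq_embed i j, embed_embed hf, leg₂_eq_embed (f i) (f j)]
  congr 1
  ext k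
  fin_cases k <;> rfl

theorem injective_pair {i j : I} (hij : i ≠ j) : Function.Injective ![i, j] := by
  intro k l
  fin_cases k <;> fin_cases l <;> simp [hij, hij.symm]

theorem injective_triple {a b c : I} (hab : a ≠ b) (hac : a ≠ c) (hbc : b ≠ c) :
    Function.Injective ![a, b, c] := by
  intro k l
  fin_cases k <;> fin_cases l <;> simp [hab, hac, hbc, hab.symm, hac.symm, hbc.symm]

theorem leg_mul (i : I) (X Y : Matrix ι ι ℂ) : leg i X * leg i Y = leg i (X * Y) := by
  have h : ∀ Z : Matrix ι ι ℂ, leg (0 : Fin 1) Z =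
      Z.submatrix (Equiv.funUnique (Fin 1) ι) (Equiv.funUnique (Fin 1) ι) := by
    intro Z
    ext a b
    simp [leg]
  have hi : Function.Injective (fun _ : Fin 1 => i) := fun _ _ _ => Subsingleton.elim _ _
  rw [leg_eq_embed i X, leg_eq_embed i Y, leg_eq_embed i (X * Y), ← embed_mul hi, h, h, h,
    Matrix.submatrix_mul_equiv]

theorem leg₂_mul {i j : I} (hij : i ≠ j) (X Y : Matrix (ι × ι) (ι × ι) ℂ) :
    leg₂ i j X * leg₂ i j Y = leg₂ i j (X * Y) := by
  have h : ∀ Z : Matrix (ι × ι) (ι × ι) ℂ, leg₂ (0 : Fin 2) 1 Z =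
      Z.submatrix (finTwoArrowEquiv ι) (finTwoArrowEquiv ι) := by
    intro Z
    ext a b
    simp [leg₂, Fin.forall_fin_two]
  rw [leg₂_eq_embed i j X, leg₂_eq_embed i j Y, leg₂_eq_embed i j (X * Y),
    ← embed_mul (injective_pair hij), h, h, h, Matrix.submatrix_mul_equiv]

theorem leg_one (i : I) : leg i (1 : Matrix ι ι ℂ) = 1 := by
  rw [leg_eq_embed, ← embed_one (fun _ : Fin 1 => i)]
  congr 1
  ext a b
  simp [leg, Matrix.one_apply, funext_iff]

theorem leg₂_one (i j : I) : leg₂ i j (1 : Matrix (ι × ι) (ι × ι) ℂ) = 1 := by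
  rw [leg₂_eq_embed, ← embed_one ![i, j]]
  congr 1
  ext a b
  simp [leg₂, Matrix.one_apply, funext_iff, Fin.forall_fin_two]

theorem leg_smul (i : I) (s : ℂ) (X : Matrix ι ι ℂ) : leg i (s • X) = s • leg i X := by
  ext a b
  simp [leg]

theorem leg₂_smul (i j : I) (s : ℂ) (X : Matrix (ι × ι) (ι × ι) ℂ) :
    leg₂ i j (s • X) = s • leg₂ i j X := by
  ext a b
  simp [leg₂]

theorem leg₂_swap (i j : I) (X : Matrix (ι × ι) (ι × ι) ℂ) :
    leg₂ j i X = leg₂ i j (X.submatrix Prod.swap Prod.swap) := by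
  ext a b
  simp only [leg₂, Matrix.submatrix_apply, Prod.swap_prod_mk]
  exact if_congr ⟨fun h k h1 h2 => h k h2 h1, fun h k h1 h2 => h k h2 h1⟩ rfl rfl

theorem commute_leg_leg {i j : I} (hij : i ≠ j) (X Y : Matrix ι ι ℂ) :
    Commute (leg i X) (leg j Y) := by
  rw [leg_eq_embed i, leg_eq_embed j]
  exact embed_commute (fun _ _ => hij) _ _

theorem commute_leg_leg₂ {i j k : I} (hij : i ≠ j) (hik : i ≠ k) (X : Matrix ι ι ℂ)
    (Y : Matrix (ι × ι) (ι × ι) ℂ) : Commute (leg i X) (leg₂ j k Y) := by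
  rw [leg_eq_embed i, leg₂_eq_embed j]
  exact embed_commute (by simp [Fin.forall_fin_two, hij, hik]) _ _

theorem commute_leg₂_leg₂ {i j k l : I} (hik : i ≠ k) (hil : i ≠ l) (hjk : j ≠ k) (hjl : j ≠ l)
    (X Y : Matrix (ι × ι) (ι × ι) ℂ) : Commute (leg₂ i j X) (leg₂ k l Y) := by
  rw [leg₂_eq_embed i, leg₂_eq_embed k]
  exact embed_commute (by simp [Fin.forall_fin_two, hik, hil, hjk, hjl]) _ _

end Embedding

/-! ### Conjugation by the flip. -/

section Flip

variable {ι : Type*} [Fintype ι] [DecidableEq ι]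
variable {I : Type*} [Fintype I] [DecidableEq I]

theorem flip_mul_flip : (flip : Matrix (ι × ι) (ι × ι) ℂ) * flip = 1 := by
  ext ⟨a, b⟩ ⟨c, d⟩
  simp [flip, Matrix.mul_apply, Fintype.sum_prod_type, Matrix.one_apply, ite_and]

theorem flip_mul_apply (X : Matrix (ι × ι) (ι × ι) ℂ) (a b : ι × ι) :
    ((flip : Matrix (ι × ι) (ι × ι) ℂ) * X) a b = X a.swap b := by
  rw [Matrix.mul_apply, Finset.sum_eq_single a.swap]
  · simp [flip]
  · rintro ⟨c, d⟩ _ h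
    rw [flip, if_neg, zero_mul]
    rintro ⟨h1, h2⟩
    exact h (Prod.ext h2.symm h1.symm)
  · simp

theorem leg₂_flip_apply {i j : I} (hij : i ≠ j) (a b : I → ι) :
    leg₂ i j flip a b = if b = a ∘ Equiv.swap i j then (1 : ℂ) else 0 := by
  simp only [leg₂, flip, ← ite_and]
  refine if_congr ⟨?_, ?_⟩ rfl rfl
  · rintro ⟨h, h1, h2⟩
    ext k
    by_cases hi : k = i
    · subst hi
      simp [h2]
    · by_cases hj : k = j
      · subst hj
        simp [h1]
      · simp [Equiv.swap_apply_of_ne_of_ne hi hj, h k hi hj]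
  · rintro rfl
    refine ⟨fun k h1 h2 => by simp [Equiv.swap_apply_of_ne_of_ne h1 h2], by simp, by simp⟩

/-- The flip of the factors `i` and `j` permutes the factors in which an operator acts. -/
theorem leg₂_flip_semiconj {i j : I} (hij : i ≠ j) (k l : I) (X : Matrix (ι × ι) (ι × ι) ℂ) :
    SemiconjBy (leg₂ i j flip) (leg₂ k l X)
      (leg₂ (Equiv.swap i j k) (Equiv.swap i j l) X) := by
  ext a b
  rw [Matrix.mul_apply, Matrix.mul_apply, Finset.sum_eq_single (a ∘ Equiv.swap i j),
    Finset.sum_eq_single (b ∘ Equiv.swap i j)]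
  · rw [leg₂_flip_apply hij, leg₂_flip_apply hij, if_pos rfl, if_pos, one_mul, mul_one]
    · simp only [leg₂, Function.comp_apply, Equiv.swap_apply_self]
      refine if_congr ⟨fun h m h1 h2 => ?_, fun h m h1 h2 => ?_⟩ rfl rfl
      · have := h (Equiv.swap i j m) (fun h' => h1 (by simp [← h'])) (fun h' => h2 (by simp [← h']))
        simpa using this
      · have := h (Equiv.swap i j m) (by simpa using h1) (by simpa using h2)
        simpa using this
    · ext m
      simp
  · intro c _ hc
    rw [leg₂_flip_apply hij, if_neg, mul_zero]
    rintro rfl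
    exact hc (by ext m; simp)
  · simp
  · intro c _ hc
    rw [leg₂_flip_apply hij, if_neg hc, zero_mul]
  · simp

/-- Viewing a one-site operator as a two-site one lets the conjugation rule for `leg₂` apply to
K-matrices. -/
theorem leg_eq_leg₂ {k l : I} (hkl : k ≠ l) (X : Matrix ι ι ℂ) :
    leg k X = leg₂ k l (X ⊗ₖ (1 : Matrix ι ι ℂ)) := by
  ext a b
  simp only [leg, leg₂, Matrix.kroneckerMap_apply, Matrix.one_apply, mul_ite, mul_one, mul_zero,
    ← ite_and]
  refine if_congr ⟨fun h => ⟨fun m h1 _ => h m h1, h l hkl.symm⟩, fun h m hm => ?_⟩ rfl rfl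
  by_cases hl : m = l
  · subst hl
    exact h.2
  · exact h.1 m hm hl

theorem leg₂_flip_semiconj_leg {i j : I} (hij : i ≠ j) (X : Matrix ι ι ℂ) :
    SemiconjBy (leg₂ i j flip) (leg j X) (leg i X) := by
  rw [leg_eq_leg₂ hij.symm, leg_eq_leg₂ hij]
  simpa using leg₂_flip_semiconj hij j i (X ⊗ₖ (1 : Matrix ι ι ℂ))

theorem leg₂_flip_semiconj_leg' {i j : I} (hij : i ≠ j) (X : Matrix ι ι ℂ) :
    SemiconjBy (leg₂ i j flip) (leg i X) (leg j X) := by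
  rw [leg_eq_leg₂ hij.symm, leg_eq_leg₂ hij]
  simpa using leg₂_flip_semiconj hij i j (X ⊗ₖ (1 : Matrix ι ι ℂ))

theorem leg₂_flip_mul_self {i j : I} (hij : i ≠ j) :
    leg₂ i j (flip : Matrix (ι × ι) (ι × ι) ℂ) * leg₂ i j flip = 1 := by
  rw [leg₂_mul hij, flip_mul_flip, leg₂_one]

end Flip

/-! ### Partial traces and the inversion defining `K'`. -/

section Trace

variable {ι : Type*} [Fintype ι] [DecidableEq ι] {N : ℕ}

theorem embed_succ_cons (Y : Matrix (Fin N → ι) (Fin N → ι) ℂ) (x y : ι) (a b : Fin N → ι) :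
    embed Fin.succ Y (Fin.cons x a : Fin (N + 1) → ι) (Fin.cons y b : Fin (N + 1) → ι) =
      if x = y then Y a b else 0 := by
  have h : ∀ (x : ι) (a : Fin N → ι), (Fin.cons x a : Fin (N + 1) → ι) ∘ Fin.succ = a := by
    intro x a
    ext k
    simp
  simp only [embed, h]
  refine if_congr ⟨fun h => by simpa using h 0, ?_⟩ rfl rfl
  rintro rfl k hk
  induction k using Fin.cases with
  | zero => rfl
  | succ k => exact absurd rfl (hk k)

theorem sum_cons (g : (Fin (N + 1) → ι) → ℂ) :
    ∑ e, g e = ∑ x : ι, ∑ a : Fin N → ι, g (Fin.cons x a) := by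
  rw [← Fintype.sum_prod_type' (f := fun x (a : Fin N → ι) => g (Fin.cons x a))]
  exact (Fintype.sum_equiv (Fin.consEquiv fun _ => ι) _ _ fun _ => rfl).symm

theorem trZero_mul_embed (Z : Matrix (Fin (N + 1) → ι) (Fin (N + 1) → ι) ℂ)
    (Y : Matrix (Fin N → ι) (Fin N → ι) ℂ) :
    trZero (Z * embed Fin.succ Y) = trZero Z * Y := by
  ext a b
  simp only [trZero, Matrix.mul_apply, sum_cons, embed_succ_cons, mul_ite, mul_zero]
  simp_rw [Finset.sum_mul]
  rw [Finset.sum_comm (s := (Finset.univ : Finset (Fin N → ι)))]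
  refine Finset.sum_congr rfl fun c _ => ?_
  rw [Finset.sum_comm]
  simp

theorem trZero_embed_mul (Z : Matrix (Fin (N + 1) → ι) (Fin (N + 1) → ι) ℂ)
    (Y : Matrix (Fin N → ι) (Fin N → ι) ℂ) :
    trZero (embed Fin.succ Y * Z) = Y * trZero Z := by
  ext a b
  simp only [trZero, Matrix.mul_apply, sum_cons, embed_succ_cons, ite_mul, zero_mul]
  simp_rw [Finset.mul_sum]
  rw [Finset.sum_comm (s := (Finset.univ : Finset (Fin N → ι)))]
  refine Finset.sum_congr rfl fun c _ => ?_
  rw [Finset.sum_comm]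
  simp

theorem trZero_smul (s : ℂ) (Z : Matrix (Fin (N + 1) → ι) (Fin (N + 1) → ι) ℂ) :
    trZero (s • Z) = s • trZero Z := by
  ext a b
  simp [trZero, Finset.mul_sum]

theorem trZero_leg₂ (i : Fin N) (X : Matrix (ι × ι) (ι × ι) ℂ) :
    trZero (leg₂ 0 i.succ X) = leg i (trFst X) := by
  ext a b
  simp only [trZero, leg₂, leg, trFst, Fin.cons_zero, Fin.cons_succ]
  split_ifs with h
  · refine Finset.sum_congr rfl fun c _ => if_pos ?_
    simpa [Fin.forall_fin_succ] using h
  · refine Finset.sum_eq_zero fun c _ => if_neg ?_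
    simpa [Fin.forall_fin_succ] using h

/-- The map `φ_{R̃}` inverts `K ↦ Tr₀ K₀ P₀₁ R₀₁`. -/
theorem trFst_phi_tilde (R : ℂ → Matrix (ι × ι) (ι × ι) ℂ) (K : ℂ → Matrix ι ι ℂ) {x : ℂ}
    (hx : IsUnit (transposeFst (R (x ^ 2)))) :
    trFst ((phi (tilde R) K x ⊗ₖ (1 : Matrix ι ι ℂ)) * (flip * R (x ^ 2))) = K x := by
  -- `A ↦ Tr₀ A₀ P₀₁ X₀₁` is linear in the entries of `A`, with coefficient matrix `X^{t₁}`. The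
  -- maps for `R` and `R̃` are therefore mutually inverse because their partial transposes are.
  have key : ∀ (A : Matrix ι ι ℂ) (X : Matrix (ι × ι) (ι × ι) ℂ) (a b : ι),
      trFst ((A ⊗ₖ (1 : Matrix ι ι ℂ)) * (flip * X)) a b =
        ∑ p : ι × ι, A p.1 p.2 * transposeFst X p (a, b) := by
    intro A X a b
    simp only [trFst, Matrix.mul_apply (M := A ⊗ₖ (1 : Matrix ι ι ℂ)),
      Matrix.kroneckerMap_apply, Fintype.sum_prod_type, transposeFst, Matrix.one_apply,
      flip_mul_apply X, Prod.swap_prod_mk]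
    simp
  have hS : ∀ p q, ∑ r, (transposeFst (R (x ^ 2)))⁻¹ p r * transposeFst (R (x ^ 2)) r q =
      if p = q then 1 else 0 := by
    intro p q
    rw [← Matrix.mul_apply, Matrix.nonsing_inv_mul _ ((Matrix.isUnit_iff_isUnit_det _).mp hx),
      Matrix.one_apply]
  ext a b
  rw [key]
  have : ∀ p : ι × ι, phi (tilde R) K x p.1 p.2 =
      ∑ q : ι × ι, K x q.1 q.2 * (transposeFst (R (x ^ 2)))⁻¹ q p := by
    intro p
    rw [phi, Matrix.mul_assoc, key]
    rfl
  simp_rw [this, Finset.sum_mul]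
  rw [Finset.sum_comm]
  simp_rw [mul_assoc, ← Finset.mul_sum, hS]
  rw [Finset.sum_eq_single (a, b)]
  · simp
  · intro q _ hq
    simp [hq]
  · simp

end Trace

/-! ### Word identities in a monoid. -/

section Monoid

variable {M : Type*} [Monoid M] {κ : Type*}

theorem mul_right_of_eq {a b : M} (h : a = b) (x : M) : a * x = b * x := by rw [h]

theorem SemiconjBy.list_prod_map {a : M} {f g : κ → M} (L : List κ)
    (h : ∀ j ∈ L, SemiconjBy a (f j) (g j)) :
    SemiconjBy a (L.map f).prod (L.map g).prod := by
  induction L with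
  | nil => simp
  | cons j L ih =>
    simp only [List.map_cons, List.prod_cons]
    exact (h j (by simp)).mul_right (ih fun k hk => h k (by simp [hk]))

/-- Factorwise commutation relations `f j U g j = g j U f j` imply the one for the products. -/
theorem prod_mul_mul_prod_reverse {f g : κ → M} {U : M} {L : List κ} (hL : L.Nodup)
    (h : ∀ j ∈ L, f j * U * g j = g j * U * f j)
    (hc : ∀ j ∈ L, ∀ k ∈ L, j ≠ k → Commute (f j) (g k)) :
    (L.map f).prod * U * (L.reverse.map g).prod = (L.reverse.map g).prod * U * (L.map f).prod := by
  induction L with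
  | nil => simp
  | cons j L ih =>
    have hj : j ∉ L := (List.nodup_cons.mp hL).1
    have h0 := ih (List.nodup_cons.mp hL).2 (fun k hk => h k (by simp [hk]))
      (fun k hk l hl => hc k (by simp [hk]) l (by simp [hl]))
    have h1 : Commute (f j) (L.reverse.map g).prod :=
      SemiconjBy.list_prod_map _ fun k hk =>
        hc j (by simp) k (by simp [List.mem_reverse.mp hk]) fun hjk =>
          hj (hjk ▸ List.mem_reverse.mp hk)
    have h2 : Commute (g j) (L.map f).prod :=
      SemiconjBy.list_prod_map _ fun k hk =>
        (hc k (by simp [hk]) j (by simp) fun hjk => hj (hjk ▸ hk)).symm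
    simp only [List.map_cons, List.prod_cons, List.reverse_cons, List.map_append, List.prod_append,
      List.map_nil, List.prod_nil, mul_one]
    calc f j * (L.map f).prod * U * ((L.reverse.map g).prod * g j)
        = f j * ((L.map f).prod * U * (L.reverse.map g).prod) * g j := by simp only [mul_assoc]
      _ = f j * (L.reverse.map g).prod * U * ((L.map f).prod * g j) := by
        rw [h0]; simp only [mul_assoc]
      _ = (L.reverse.map g).prod * (f j * U * g j) * (L.map f).prod := by
        rw [h1.eq, ← h2.eq]; simp only [mul_assoc]
      _ = _ := by
        rw [h j (by simp)]; simp only [mul_assoc]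

theorem prod_map_mul_prod_map {f g : κ → M} {L : List κ} (hL : L.Nodup)
    (hc : ∀ j ∈ L, ∀ k ∈ L, j ≠ k → Commute (g j) (f k)) :
    (L.map f).prod * (L.map g).prod = (L.map fun j => f j * g j).prod := by
  induction L with
  | nil => simp
  | cons j L ih =>
    have hj : j ∉ L := (List.nodup_cons.mp hL).1
    have h1 : Commute (g j) (L.map f).prod :=
      SemiconjBy.list_prod_map _ fun k hk =>
        hc j (by simp) k (by simp [hk]) fun hjk => hj (hjk ▸ hk)
    simp only [List.map_cons, List.prod_cons]
    rw [← ih (List.nodup_cons.mp hL).2 (fun k hk l hl => hc k (by simp [hk]) l (by simp [hl]))]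
    calc f j * (L.map f).prod * (g j * (L.map g).prod)
        = f j * ((L.map f).prod * g j) * (L.map g).prod := by simp only [mul_assoc]
      _ = _ := by rw [← h1.eq]; simp only [mul_assoc]

/-- The commutations allow both sides to be regrouped into products of pairs `f j * g j` and `g j *
f j`; then `a` passes one pair at a time. -/
theorem semiconj_prod_mul_prod {a : M} {f g : κ → M} {L : List κ} (hL : L.Nodup)
    (h : ∀ j ∈ L, a * f j * g j = g j * f j * a)
    (hc : ∀ j ∈ L, ∀ k ∈ L, j ≠ k → Commute (f j) (g k)) :
    a * (L.map f).prod * (L.map g).prod = (L.map g).prod * (L.map f).prod * a := by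
  rw [mul_assoc, prod_map_mul_prod_map hL fun j hj k hk hjk => (hc k hk j hj hjk.symm).symm,
    prod_map_mul_prod_map hL hc]
  refine SemiconjBy.list_prod_map L fun j hj => ?_
  rw [SemiconjBy, ← mul_assoc, h j hj]

/-- Dressing a solution of the left reflection equation. -/
theorem dressed_left_reflection {w w' p₁ p₂ u₁₂ u₂₁ T₁ T₂ S₁ S₂ : M}
    (hT₁ : T₁ * u₂₁ * S₂ = S₂ * u₂₁ * T₁) (hT₂ : T₂ * u₁₂ * S₁ = S₁ * u₁₂ * T₂)
    (hT : w' * T₁ * T₂ = T₂ * T₁ * w') (hS : w * S₁ * S₂ = S₂ * S₁ * w)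
    (hp₁S : Commute p₁ S₂) (hp₂S : Commute p₂ S₁) (hp₁T : Commute p₁ T₂) (hp₂T : Commute p₂ T₁)
    (h : w * p₁ * u₂₁ * p₂ = p₂ * u₁₂ * p₁ * w') :
    w * (S₁ * p₁ * T₁) * u₂₁ * (S₂ * p₂ * T₂) = S₂ * p₂ * T₂ * u₁₂ * (S₁ * p₁ * T₁) * w' := by
  -- With a trailing `x`, every relation can be used as a rewrite rule anywhere inside a fully
  -- right-associated word.
  suffices ∀ x, w * (S₁ * p₁ * T₁) * u₂₁ * (S₂ * p₂ * T₂) * x =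
      S₂ * p₂ * T₂ * u₁₂ * (S₁ * p₁ * T₁) * w' * x by simpa using this 1
  intro x
  have e1 := mul_right_of_eq hT₁
  have e2 := mul_right_of_eq hT₂
  have e3 := mul_right_of_eq hT
  have e4 := mul_right_of_eq hS
  have e5 := mul_right_of_eq hp₁S.eq
  have e6 := mul_right_of_eq hp₂S.eq
  have e7 := mul_right_of_eq hp₁T.eq
  have e8 := mul_right_of_eq hp₂T.eq
  have e9 := mul_right_of_eq h
  simp only [mul_assoc] at e1 e2 e3 e4 e5 e6 e7 e8 e9 ⊢
  rw [e1, e5, ← e8, e4, e9, e3, e7, ← e6, ← e2]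

/-- Dressing a solution of the right reflection equation. -/
theorem dressed_right_reflection {w w' m₁ m₂ u₁₂ u₂₁ T₁ T₂ S₁ S₂ : M}
    (hT₁ : T₁ * u₂₁ * S₂ = S₂ * u₂₁ * T₁) (hT₂ : T₂ * u₁₂ * S₁ = S₁ * u₁₂ * T₂)
    (hT : w' * T₁ * T₂ = T₂ * T₁ * w') (hS : w * S₁ * S₂ = S₂ * S₁ * w)
    (hm₁S : Commute m₁ S₂) (hm₂S : Commute m₂ S₁) (hm₁T : Commute m₁ T₂) (hm₂T : Commute m₂ T₁)
    (h : w' * m₁ * u₁₂ * m₂ = m₂ * u₂₁ * m₁ * w) :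
    w' * (T₁ * m₁ * S₁) * u₁₂ * (T₂ * m₂ * S₂) = T₂ * m₂ * S₂ * u₂₁ * (T₁ * m₁ * S₁) * w := by
  suffices ∀ x, w' * (T₁ * m₁ * S₁) * u₁₂ * (T₂ * m₂ * S₂) * x =
      T₂ * m₂ * S₂ * u₂₁ * (T₁ * m₁ * S₁) * w * x by simpa using this 1
  intro x
  have e1 := mul_right_of_eq hT₁
  have e2 := mul_right_of_eq hT₂
  have e3 := mul_right_of_eq hT
  have e4 := mul_right_of_eq hS
  have e5 := mul_right_of_eq hm₁S.eq
  have e6 := mul_right_of_eq hm₂S.eq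
  have e7 := mul_right_of_eq hm₁T.eq
  have e8 := mul_right_of_eq hm₂T.eq
  have e9 := mul_right_of_eq h
  simp only [mul_assoc] at e1 e2 e3 e4 e5 e6 e7 e8 e9 ⊢
  rw [← e2, e7, ← e6, e3, e9, e4, e5, ← e8, e1]

/-- Indices 1, 2 stand for sites `i < j`: `E` is the left K-matrix dressed by the sites before `i`,
`D` the right one dressed by the sites after `j`, and `T`, `S` run over the sites between. Both
orders reduce to the same word. One uses the exchange of `S₁` with `S₂` and the cancellation `w₁₂
w₂₁ = C`; the other uses the two reflection equations, the exchange of `T₁` with `T₂`, and `w₂₁ w₁₂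
= C`. -/
theorem commute_of_dressed_reflections {w₁₂ w₂₁ w' u₁₂ u₂₁ E₁ E₂ D₁ D₂ T₁ T₂ S₁ S₂ C : M}
    (hT₁ : T₁ * u₂₁ * S₂ = S₂ * u₂₁ * T₁) (hT₂ : T₂ * u₁₂ * S₁ = S₁ * u₁₂ * T₂)
    (hT : w' * T₁ * T₂ = T₂ * T₁ * w') (hS : w₁₂ * S₁ * S₂ = S₂ * S₁ * w₁₂)
    (hC₁ : w₁₂ * w₂₁ = C) (hC₂ : w₂₁ * w₁₂ = C) (hC : ∀ x, Commute C x)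
    (hE : w₁₂ * E₁ * u₂₁ * E₂ = E₂ * u₁₂ * E₁ * w')
    (hD : w' * D₁ * u₁₂ * D₂ = D₂ * u₂₁ * D₁ * w₁₂)
    (hE₁S : Commute E₁ S₂) (hE₂S : Commute E₂ S₁) (hE₁T : Commute E₁ T₂) (hE₂T : Commute E₂ T₁)
    (hD₁S : Commute D₁ S₂) (hD₂S : Commute D₂ S₁) (hD₁T : Commute D₁ T₂) (hD₂T : Commute D₂ T₁)
    (hED₁ : Commute E₁ D₂) (hED₂ : Commute E₂ D₁) :
    Commute (E₁ * T₁ * u₂₁ * D₁ * w₁₂ * S₁) (S₂ * w₂₁ * E₂ * u₁₂ * T₂ * D₂) := by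
  suffices ∀ x, E₁ * T₁ * u₂₁ * D₁ * w₁₂ * S₁ * (S₂ * w₂₁ * E₂ * u₁₂ * T₂ * D₂) * x =
      S₂ * w₂₁ * E₂ * u₁₂ * T₂ * D₂ * (E₁ * T₁ * u₂₁ * D₁ * w₁₂ * S₁) * x by
    simpa [Commute, SemiconjBy] using this 1
  intro x
  have e1 := mul_right_of_eq hT₁
  have e2 := mul_right_of_eq hT₂
  have e3 := mul_right_of_eq hT
  have e4 := mul_right_of_eq hS
  have e5 := mul_right_of_eq hC₁
  have e6 := mul_right_of_eq hC₂
  have e7 := mul_right_of_eq hE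
  have e8 := mul_right_of_eq hD
  have c1 := mul_right_of_eq hE₁S.eq
  have c2 := mul_right_of_eq hE₂S.eq
  have c3 := mul_right_of_eq hE₁T.eq
  have c4 := mul_right_of_eq hE₂T.eq
  have c5 := mul_right_of_eq hD₁S.eq
  have c6 := mul_right_of_eq hD₂S.eq
  have c7 := mul_right_of_eq hD₁T.eq
  have c8 := mul_right_of_eq hD₂T.eq
  have c9 := mul_right_of_eq hED₁.eq
  have c10 := mul_right_of_eq hED₂.eq
  have cC := fun y => mul_right_of_eq (hC y).eq
  simp only [mul_assoc] at e1 e2 e3 e4 e5 e6 e7 e8 c1 c2 c3 c4 c5 c6 c7 c8 c9 c10 cC ⊢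
  have lhs : E₁ * (T₁ * (u₂₁ * (D₁ * (w₁₂ * (S₁ * (S₂ * (w₂₁ * (E₂ * (u₁₂ * (T₂ * (D₂ * x)))))))))))
      = C * (S₂ * (E₁ * (u₂₁ * (E₂ * (T₁ * (T₂ * (D₁ * (u₁₂ * (D₂ * (S₁ * x)))))))))) := by
    rw [e4, c5, e1, c1, e5, ← cC S₁, ← cC D₁, ← cC T₁, ← cC u₂₁, ← cC E₁, ← cC S₂, ← c2, ← c10,
      ← c4, ← e2, c7, ← c6]
  have rhs : S₂ * (w₂₁ * (E₂ * (u₁₂ * (T₂ * (D₂ * (E₁ * (T₁ * (u₂₁ * (D₁ * (w₁₂ * (S₁ * x)))))))))))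
      = C * (S₂ * (E₁ * (u₂₁ * (E₂ * (T₁ * (T₂ * (D₁ * (u₁₂ * (D₂ * (S₁ * x)))))))))) := by
    rw [← c9, ← c3, c8, ← e8, ← e3, ← e7, e6, ← cC S₂]
  rw [lhs, rhs]

end Monoid

theorem disjoint_insert_toFinset {I : Type*} [DecidableEq I] {i j : I} {L K : List I}
    (h : (i :: L ++ j :: K).Nodup) : Disjoint (insert i L.toFinset) (insert j K.toFinset) := by
  rw [← List.toFinset_cons, ← List.toFinset_cons, List.disjoint_toFinset_iff_disjoint]
  exact List.disjoint_of_nodup_append h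

/-! ### Commutation from disjoint supports. -/

section Support

variable {ι : Type*} [Fintype ι] [DecidableEq ι]
variable {I : Type*} [Fintype I] [DecidableEq I]

/-- The operators on `V^{⊗I}` acting trivially in the tensor factors outside `S`. -/
def actsIn (S : Finset I) : Submonoid (Matrix (I → ι) (I → ι) ℂ) where
  carrier := {X | ∃ Y : Matrix (S → ι) (S → ι) ℂ, embed (Subtype.val : S → I) Y = X}
  one_mem' := ⟨1, embed_one _⟩
  mul_mem' := by
    rintro _ _ ⟨X, rfl⟩ ⟨Y, rfl⟩
    exact ⟨X * Y, embed_mul Subtype.val_injective X Y⟩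

theorem actsIn_mono {S T : Finset I} (h : S ⊆ T) :
    (actsIn S : Submonoid (Matrix (I → ι) (I → ι) ℂ)) ≤ actsIn T := by
  rintro _ ⟨Y, rfl⟩
  exact ⟨embed (fun s : S => (⟨s, h s.2⟩ : T)) Y, by rw [embed_embed Subtype.val_injective]; rfl⟩

theorem commute_of_mem_actsIn {S T : Finset I} (h : Disjoint S T)
    {X Y : Matrix (I → ι) (I → ι) ℂ} (hX : X ∈ actsIn S) (hY : Y ∈ actsIn T) : Commute X Y := by
  obtain ⟨X, rfl⟩ := hX
  obtain ⟨Y, rfl⟩ := hY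
  exact embed_commute (fun j l hjl => Finset.disjoint_left.mp h j.2 (hjl ▸ l.2)) X Y

theorem leg_mem_actsIn {S : Finset I} {i : I} (hi : i ∈ S) (X : Matrix ι ι ℂ) :
    leg i X ∈ (actsIn S : Submonoid (Matrix (I → ι) (I → ι) ℂ)) :=
  ⟨leg ⟨i, hi⟩ X, embed_leg Subtype.val_injective _ _⟩

theorem leg₂_mem_actsIn {S : Finset I} {i j : I} (hi : i ∈ S) (hj : j ∈ S)
    (X : Matrix (ι × ι) (ι × ι) ℂ) :
    leg₂ i j X ∈ (actsIn S : Submonoid (Matrix (I → ι) (I → ι) ℂ)) :=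
  ⟨leg₂ ⟨i, hi⟩ ⟨j, hj⟩ X, embed_leg₂ Subtype.val_injective _ _ _⟩

end Support

/-! ### Commuting chain operators from braid and reflection relations. -/

section Braiding

variable {ι : Type*} [Fintype ι] [DecidableEq ι]
variable {I : Type*} [Fintype I] [DecidableEq I]

/-- The relations between `u i j = R_{ij}(z_i z_j)`, `w i j = R_{ij}(z_i / z_j)`,
`w' j i = R_{ji}(z_i / z_j)`, `p i = K⁺_i(z_i)` and `m i = K⁻_i(z_i)`. -/
structure BoundaryBraiding (u w w' : I → I → Matrix (I → ι) (I → ι) ℂ)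
    (p m : I → Matrix (I → ι) (I → ι) ℂ) : Prop where
  u_mem : ∀ i j, u i j ∈ (actsIn {i, j} : Submonoid (Matrix (I → ι) (I → ι) ℂ))
  w_mem : ∀ i j, w i j ∈ (actsIn {i, j} : Submonoid (Matrix (I → ι) (I → ι) ℂ))
  p_mem : ∀ i, p i ∈ (actsIn {i} : Submonoid (Matrix (I → ι) (I → ι) ℂ))
  m_mem : ∀ i, m i ∈ (actsIn {i} : Submonoid (Matrix (I → ι) (I → ι) ℂ))
  braid_w : ∀ a b c, a ≠ b → a ≠ c → b ≠ c → w a b * w a c * w b c = w b c * w a c * w a b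
  braid_u : ∀ a b c, a ≠ b → a ≠ c → b ≠ c → w a b * u a c * u b c = u b c * u a c * w a b
  braid_w' : ∀ a b c, a ≠ b → a ≠ c → b ≠ c → w' b c * u a c * u a b = u a b * u a c * w' b c
  left : ∀ i j, i ≠ j → w i j * p i * u j i * p j = p j * u i j * p i * w' j i
  right : ∀ i j, i ≠ j → w' j i * m i * u i j * m j = m j * u j i * m i * w i j
  unitary : ∀ i j, i ≠ j → ∃ c : ℂ, w i j * w j i = c • 1 ∧ w j i * w i j = c • 1

/-- The operator `w_{i,i-1} ⋯ w_{i,1} p_i u_{1,i} ⋯ u_{N,i} m_i w_{i,N} ⋯ w_{i,i+1}`, for a chain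
split into the list `L₁` of sites before `i` and the list `L₂` of sites after `i`. -/
def chainOperator {M : Type*} [Monoid M] (u w : I → I → M) (p m : I → M) (i : I)
    (L₁ L₂ : List I) : M :=
  (L₁.reverse.map (w i)).prod * p i * (L₁.map fun l => u l i).prod * (L₂.map fun l => u l i).prod *
    m i * (L₂.reverse.map (w i)).prod

namespace BoundaryBraiding

variable {u w w' : I → I → Matrix (I → ι) (I → ι) ℂ} {p m : I → Matrix (I → ι) (I → ι) ℂ}

section

variable (h : BoundaryBraiding u w w' p m)
include h

theorem prod_u_mem (i : I) (L : List I) : (L.map fun l => u l i).prod ∈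
    (actsIn (insert i L.toFinset) : Submonoid (Matrix (I → ι) (I → ι) ℂ)) := by
  refine list_prod_mem fun x hx => ?_
  obtain ⟨l, hl, rfl⟩ := List.mem_map.mp hx
  exact actsIn_mono (by simp [Finset.insert_subset_iff, hl]) (h.u_mem l i)

theorem prod_w_mem (i : I) (L : List I) : (L.reverse.map (w i)).prod ∈
    (actsIn (insert i L.toFinset) : Submonoid (Matrix (I → ι) (I → ι) ℂ)) := by
  refine list_prod_mem fun x hx => ?_
  obtain ⟨l, hl, rfl⟩ := List.mem_map.mp hx
  exact actsIn_mono (by simpa [Finset.insert_subset_iff] using Or.inr hl) (h.w_mem i l)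

/-- This exchange and the two that follow are Yang–Baxter iterated over the sites of `L`; they are
the hypotheses needed for dressing. -/
theorem prod_u_mul_prod_w {i j : I} {L : List I} (hL : (i :: j :: L).Nodup) :
    (L.map fun l => u l i).prod * u j i * (L.reverse.map (w j)).prod =
      (L.reverse.map (w j)).prod * u j i * (L.map fun l => u l i).prod := by
  refine prod_mul_mul_prod_reverse (by grind) (fun l hl => ?_) fun l hl k hk hlk => ?_
  · exact (h.braid_u j l i (by grind) (by grind) (by grind)).symm
  · exact commute_of_mem_actsIn (by simp; grind) (h.u_mem l i) (h.w_mem j k)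

theorem prod_u_mul_prod_u {i j : I} {L : List I} (hL : (i :: j :: L).Nodup) :
    w' j i * (L.map fun l => u l i).prod * (L.map fun l => u l j).prod =
      (L.map fun l => u l j).prod * (L.map fun l => u l i).prod * w' j i := by
  refine semiconj_prod_mul_prod (by grind) (fun l hl => ?_) fun l hl k hk hlk => ?_
  · exact h.braid_w' l j i (by grind) (by grind) (by grind)
  · exact commute_of_mem_actsIn (by simp; grind) (h.u_mem l i) (h.u_mem k j)

theorem prod_w_mul_prod_w {i j : I} {L : List I} (hL : (i :: j :: L).Nodup) :
    w i j * (L.reverse.map (w i)).prod * (L.reverse.map (w j)).prod =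
      (L.reverse.map (w j)).prod * (L.reverse.map (w i)).prod * w i j := by
  refine semiconj_prod_mul_prod (by grind [List.nodup_reverse]) (fun l hl => ?_)
    fun l hl k hk hlk => ?_
  · exact h.braid_w i j l (by grind) (by grind) (by grind)
  · exact commute_of_mem_actsIn (by simp; grind) (h.w_mem i l) (h.w_mem j k)

/-- The chain operators of two different sites commute. -/
theorem commute_chainOperator {i j : I} {L₁ L₂ L₃ : List I}
    (hL : (L₁ ++ i :: (L₂ ++ j :: L₃)).Nodup) :
    Commute (chainOperator u w p m i L₁ (L₂ ++ j :: L₃))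
      (chainOperator u w p m j (L₁ ++ i :: L₂) L₃) := by
  have hij : i ≠ j := by grind
  have n12 : (i :: L₁ ++ j :: L₂).Nodup := by grind
  have n12' : (j :: L₁ ++ i :: L₂).Nodup := by grind
  have n32 : (i :: L₃ ++ j :: L₂).Nodup := by grind
  have n32' : (j :: L₃ ++ i :: L₂).Nodup := by grind
  have n13 : (i :: L₁ ++ j :: L₃).Nodup := by grind
  have n13' : (j :: L₁ ++ i :: L₃).Nodup := by grind
  have n1 : (i :: j :: L₁).Nodup := by grind
  have n1' : (j :: i :: L₁).Nodup := by grind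
  have n2 : (i :: j :: L₂).Nodup := by grind
  have n2' : (j :: i :: L₂).Nodup := by grind
  have n3 : (i :: j :: L₃).Nodup := by grind
  have n3' : (j :: i :: L₃).Nodup := by grind
  have pS : ∀ a b : I, ∀ L : List I, (a :: b :: L).Nodup → Commute (p a) (L.reverse.map (w b)).prod :=
    fun a b L hn => commute_of_mem_actsIn (by simp; grind) (h.p_mem a) (h.prod_w_mem b L)
  have pT : ∀ a b : I, ∀ L : List I, (a :: b :: L).Nodup → Commute (p a) (L.map fun l => u l b).prod :=
    fun a b L hn => commute_of_mem_actsIn (by simp; grind) (h.p_mem a) (h.prod_u_mem b L)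
  have mS : ∀ a b : I, ∀ L : List I, (a :: b :: L).Nodup → Commute (m a) (L.reverse.map (w b)).prod :=
    fun a b L hn => commute_of_mem_actsIn (by simp; grind) (h.m_mem a) (h.prod_w_mem b L)
  have mT : ∀ a b : I, ∀ L : List I, (a :: b :: L).Nodup → Commute (m a) (L.map fun l => u l b).prod :=
    fun a b L hn => commute_of_mem_actsIn (by simp; grind) (h.m_mem a) (h.prod_u_mem b L)
  -- The undressed reflection equations are dressed by the sites outside the interval from `i` to
  -- `j`: `L₁` for the left one and `L₃` for the right one. `L₂` is treated separately in `key`.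
  have hE := dressed_left_reflection (h.prod_u_mul_prod_w n1) (h.prod_u_mul_prod_w n1')
    (h.prod_u_mul_prod_u n1) (h.prod_w_mul_prod_w n1) (pS i j _ n1) (pS j i _ n1') (pT i j _ n1)
    (pT j i _ n1') (h.left i j hij)
  have hD := dressed_right_reflection (h.prod_u_mul_prod_w n3) (h.prod_u_mul_prod_w n3')
    (h.prod_u_mul_prod_u n3) (h.prod_w_mul_prod_w n3) (mS i j _ n3) (mS j i _ n3') (mT i j _ n3)
    (mT j i _ n3') (h.right i j hij)
  have memE : ∀ a, (L₁.reverse.map (w a)).prod * p a * (L₁.map fun l => u l a).prod ∈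
      (actsIn (insert a L₁.toFinset) : Submonoid (Matrix (I → ι) (I → ι) ℂ)) := fun a =>
    mul_mem (mul_mem (h.prod_w_mem a _) (actsIn_mono (by simp) (h.p_mem a))) (h.prod_u_mem a _)
  have memD : ∀ a, (L₃.map fun l => u l a).prod * m a * (L₃.reverse.map (w a)).prod ∈
      (actsIn (insert a L₃.toFinset) : Submonoid (Matrix (I → ι) (I → ι) ℂ)) := fun a =>
    mul_mem (mul_mem (h.prod_u_mem a _) (actsIn_mono (by simp) (h.m_mem a))) (h.prod_w_mem a _)
  obtain ⟨c, hc1, hc2⟩ := h.unitary i j hij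
  have key := commute_of_dressed_reflections (h.prod_u_mul_prod_w n2) (h.prod_u_mul_prod_w n2')
    (h.prod_u_mul_prod_u n2) (h.prod_w_mul_prod_w n2) hc1 hc2
    (fun x => by rw [Commute, SemiconjBy, smul_mul_assoc, mul_smul_comm, one_mul, mul_one]) hE hD
    (commute_of_mem_actsIn (disjoint_insert_toFinset n12) (memE i) (h.prod_w_mem j _))
    (commute_of_mem_actsIn (disjoint_insert_toFinset n12') (memE j) (h.prod_w_mem i _))
    (commute_of_mem_actsIn (disjoint_insert_toFinset n12) (memE i) (h.prod_u_mem j _))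
    (commute_of_mem_actsIn (disjoint_insert_toFinset n12') (memE j) (h.prod_u_mem i _))
    (commute_of_mem_actsIn (disjoint_insert_toFinset n32) (memD i) (h.prod_w_mem j _))
    (commute_of_mem_actsIn (disjoint_insert_toFinset n32') (memD j) (h.prod_w_mem i _))
    (commute_of_mem_actsIn (disjoint_insert_toFinset n32) (memD i) (h.prod_u_mem j _))
    (commute_of_mem_actsIn (disjoint_insert_toFinset n32') (memD j) (h.prod_u_mem i _))
    (commute_of_mem_actsIn (disjoint_insert_toFinset n13) (memE i) (memD j))
    (commute_of_mem_actsIn (disjoint_insert_toFinset n13') (memE j) (memD i))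
  simp only [chainOperator, List.map_append, List.map_cons, List.prod_append, List.prod_cons,
    List.reverse_append, List.reverse_cons, List.map_nil, List.prod_nil, mul_one, mul_assoc]
    at key ⊢
  exact key

end

end BoundaryBraiding

end Braiding

/-! ### Evaluating the auxiliary trace when an R-matrix is a flip. -/

section Trace

/-- `P` stands for the flip of factors 0 and `i`, and primes mark the operators with 0 replaced by
`i`. Pulling `P` left past `C`, `k`, `B` and then moving `D` across leaves factor 0 only in `k₀ * Q
* P`, flanked by operators on the chain. -/
theorem reorder_of_semiconj_flip {M : Type*} [Monoid M]
    {k₀ Q P A A' B B' k k' C C' D D' : M}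
    (hA : SemiconjBy P A' A) (hB : SemiconjBy P B' B) (hk : SemiconjBy P k' k)
    (hC : SemiconjBy P C' C) (hD : SemiconjBy P D D')
    (hBD : Commute B' D) (hkD : Commute k' D) (hCD : Commute C' D) (h₀ : Commute k₀ D')
    (hex : A * Q * D' = D' * Q * A) :
    k₀ * (A * (Q * B)) * k * (C * (P * D)) = D' * (k₀ * Q * P) * (A' * B' * k' * C') := by
  suffices ∀ x, k₀ * (A * (Q * B)) * k * (C * (P * D)) * x =
      D' * (k₀ * Q * P) * (A' * B' * k' * C') * x by simpa using this 1
  intro x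
  have e1 := mul_right_of_eq hA.eq
  have e2 := mul_right_of_eq hB.eq
  have e3 := mul_right_of_eq hk.eq
  have e4 := mul_right_of_eq hC.eq
  have e5 := mul_right_of_eq hD.eq
  have e6 := mul_right_of_eq hBD.eq
  have e7 := mul_right_of_eq hkD.eq
  have e8 := mul_right_of_eq hCD.eq
  have e9 := mul_right_of_eq h₀.eq
  have e10 := mul_right_of_eq hex
  simp only [mul_assoc] at e1 e2 e3 e4 e5 e6 e7 e8 e9 e10 ⊢
  rw [← e4, ← e3, ← e2, e8, e7, e6, e5, e10, e9, ← e1]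

/-- The counterpart with the flip in the left half of the word: `P` is moved right, past `B`, `k`,
`C`, until it meets `Q`. -/
theorem reorder_of_semiconj_flip' {M : Type*} [Monoid M]
    {k₀ Q P A A' B B' k k' C C' D D' : M}
    (hA : SemiconjBy P A' A) (hB : SemiconjBy P B B') (hk : SemiconjBy P k k')
    (hC : SemiconjBy P C C') (hD : SemiconjBy P D D')
    (hBA : Commute B' A) (hkA : Commute k' A) (hCA : Commute C' A)
    (hB₀ : Commute k₀ B') (hk₀ : Commute k₀ k') (hC₀ : Commute k₀ C') (hD₀ : Commute k₀ D')
    (hex : A' * Q * D = D * Q * A') :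
    k₀ * (A * (P * B)) * k * (C * (Q * D)) = (B' * k' * C' * D') * (k₀ * P * Q) * A' := by
  suffices ∀ x, k₀ * (A * (P * B)) * k * (C * (Q * D)) * x =
      (B' * k' * C' * D') * (k₀ * P * Q) * A' * x by simpa using this 1
  intro x
  have e1 := mul_right_of_eq hA.eq
  have e2 := mul_right_of_eq hB.eq
  have e3 := mul_right_of_eq hk.eq
  have e4 := mul_right_of_eq hC.eq
  have e5 := mul_right_of_eq hD.eq
  have e6 := mul_right_of_eq hBA.eq
  have e7 := mul_right_of_eq hkA.eq
  have e8 := mul_right_of_eq hCA.eq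
  have e9 := mul_right_of_eq hB₀.eq
  have e10 := mul_right_of_eq hk₀.eq
  have e11 := mul_right_of_eq hC₀.eq
  have e12 := mul_right_of_eq hD₀.eq
  have e13 := mul_right_of_eq hex
  simp only [mul_assoc] at e1 e2 e3 e4 e5 e6 e7 e8 e9 e10 e11 e12 e13 ⊢
  rw [e2, e3, e4, ← e6, e9, ← e7, e10, ← e8, e11, ← e1, e13, e5, e12]

variable {ι : Type*} [Fintype ι] [DecidableEq ι] {N : ℕ}

theorem embed_list_prod {I J : Type*} [Fintype I] [DecidableEq I] [Fintype J] [DecidableEq J]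
    {f : J → I} (hf : Function.Injective f) {κ : Type*} (L : List κ)
    (g : κ → Matrix (J → ι) (J → ι) ℂ) :
    embed f (L.map g).prod = (L.map fun j => embed f (g j)).prod := by
  induction L with
  | nil => simp [embed_one]
  | cons j L ih => simp [embed_mul hf, ih]

theorem trZero_leg_mul_flip_mul (i : Fin N) (A : Matrix ι ι ℂ) (Q : Matrix (ι × ι) (ι × ι) ℂ) :
    trZero (leg 0 A * leg₂ 0 i.succ flip * leg₂ 0 i.succ Q) =
      leg i (trFst ((A ⊗ₖ (1 : Matrix ι ι ℂ)) * (flip * Q))) := by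
  have h : (0 : Fin (N + 1)) ≠ i.succ := (Fin.succ_ne_zero i).symm
  rw [leg_eq_leg₂ h, leg₂_mul h, leg₂_mul h, trZero_leg₂, Matrix.mul_assoc]

theorem flip_semiconj_zero_succ {i j : Fin N} (hij : j ≠ i) (X : Matrix (ι × ι) (ι × ι) ℂ) :
    SemiconjBy (leg₂ (0 : Fin (N + 1)) i.succ flip) (leg₂ 0 j.succ X) (leg₂ i.succ j.succ X) := by
  have h := leg₂_flip_semiconj (Fin.succ_ne_zero i).symm 0 j.succ X
  rwa [Equiv.swap_apply_left, Equiv.swap_apply_of_ne_of_ne (Fin.succ_ne_zero j)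
    (fun h => hij (Fin.succ_injective _ h))] at h

theorem flip_semiconj_succ_succ {i j : Fin N} (hij : j ≠ i) (X : Matrix (ι × ι) (ι × ι) ℂ) :
    SemiconjBy (leg₂ (0 : Fin (N + 1)) i.succ flip) (leg₂ i.succ j.succ X) (leg₂ 0 j.succ X) := by
  have h := leg₂_flip_semiconj (Fin.succ_ne_zero i).symm i.succ j.succ X
  rwa [Equiv.swap_apply_right, Equiv.swap_apply_of_ne_of_ne (Fin.succ_ne_zero j)
    (fun h => hij (Fin.succ_injective _ h))] at h

theorem flip_semiconj_succ_succ' {i j : Fin N} (hij : j ≠ i) (X : Matrix (ι × ι) (ι × ι) ℂ) :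
    SemiconjBy (leg₂ (0 : Fin (N + 1)) i.succ flip) (leg₂ j.succ i.succ X) (leg₂ j.succ 0 X) := by
  rw [leg₂_swap i.succ j.succ X, leg₂_swap 0 j.succ X]
  exact flip_semiconj_succ_succ hij _

/-- Evaluation of the trace over the auxiliary factor when the monodromy on the right degenerates
to a flip. -/
theorem trZero_flip_right {i : Fin N} {L₁ L₂ : List (Fin N)} (hL : (L₁ ++ i :: L₂).Nodup)
    {A B K : Matrix ι ι ℂ} {Q : Matrix (ι × ι) (ι × ι) ℂ}
    {U W : Fin N → Matrix (ι × ι) (ι × ι) ℂ}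
    (hA : trFst ((A ⊗ₖ (1 : Matrix ι ι ℂ)) * (flip * Q)) = B)
    (hY : ∀ j ∈ L₁, leg₂ j.succ 0 (U j) * leg₂ i.succ 0 Q * leg₂ i.succ j.succ (W j) =
      leg₂ i.succ j.succ (W j) * leg₂ i.succ 0 Q * leg₂ j.succ (0 : Fin (N + 1)) (U j)) :
    trZero (leg 0 A * ((L₁.map fun j => leg₂ j.succ 0 (U j)).prod *
        (leg₂ i.succ 0 Q * (L₂.map fun j => leg₂ j.succ 0 (U j)).prod)) * leg 0 K *
        ((L₂.reverse.map fun j => leg₂ 0 j.succ (W j)).prod * (leg₂ 0 i.succ flip *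
          (L₁.reverse.map fun j => leg₂ 0 j.succ (W j)).prod))) =
      (L₁.reverse.map fun j => leg₂ i j (W j)).prod * leg i B *
        (L₁.map fun j => leg₂ j i (U j)).prod * (L₂.map fun j => leg₂ j i (U j)).prod *
        leg i K * (L₂.reverse.map fun j => leg₂ i j (W j)).prod := by
  have h1 : ∀ j ∈ L₁, j ≠ i := by grind
  have h2 : ∀ j ∈ L₂, j ≠ i := by grind
  have h12 : ∀ j ∈ L₂, ∀ k ∈ L₁, j ≠ k := by grind
  have hn : L₁.Nodup := by grind
  have ne : ∀ {j k : Fin N}, j ≠ k → j.succ ≠ k.succ := fun h h' => h (Fin.succ_injective _ h')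
  have n0 : ∀ j : Fin N, (0 : Fin (N + 1)) ≠ j.succ := fun j => (Fin.succ_ne_zero j).symm
  have hs : Function.Injective (Fin.succ : Fin N → Fin (N + 1)) := Fin.succ_injective N
  rw [reorder_of_semiconj_flip
    (A' := (L₁.map fun j => leg₂ j.succ i.succ (U j)).prod)
    (B' := (L₂.map fun j => leg₂ j.succ i.succ (U j)).prod)
    (k' := leg i.succ K) (C' := (L₂.reverse.map fun j => leg₂ i.succ j.succ (W j)).prod)
    (D' := (L₁.reverse.map fun j => leg₂ i.succ j.succ (W j)).prod)]
  -- Passing through the flip turns `Q_{i0}` into `Q_{0i}`, the form of the trace evaluated by `hA`.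
  · have h0 : leg₂ i.succ 0 Q * leg₂ 0 i.succ flip = leg₂ 0 i.succ flip * leg₂ 0 i.succ Q := by
      have h := leg₂_flip_semiconj (n0 i) 0 i.succ Q
      rw [Equiv.swap_apply_left, Equiv.swap_apply_right] at h
      exact h.eq.symm
    have e1 : ∀ L : List (Fin N), (L.map fun j => leg₂ i.succ j.succ (W j)).prod =
        embed Fin.succ (L.map fun j => leg₂ i j (W j)).prod := fun L => by
      simp only [embed_list_prod hs, embed_leg₂ hs]
    have e2 : ∀ L : List (Fin N), (L.map fun j => leg₂ j.succ i.succ (U j)).prod =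
        embed Fin.succ (L.map fun j => leg₂ j i (U j)).prod := fun L => by
      simp only [embed_list_prod hs, embed_leg₂ hs]
    rw [mul_assoc (leg 0 A), h0, ← mul_assoc (leg 0 A), e1, e1, e2, e2, ← embed_leg hs,
      ← embed_mul hs, ← embed_mul hs, ← embed_mul hs, trZero_mul_embed, trZero_embed_mul,
      trZero_leg_mul_flip_mul, hA]
    simp only [mul_assoc]
  · exact SemiconjBy.list_prod_map _ fun j hj => flip_semiconj_succ_succ' (h1 j hj) _
  · exact SemiconjBy.list_prod_map _ fun j hj => flip_semiconj_succ_succ' (h2 j hj) _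
  · exact leg₂_flip_semiconj_leg (n0 i) K
  · exact SemiconjBy.list_prod_map _ fun j hj =>
      flip_semiconj_succ_succ (h2 j (List.mem_reverse.mp hj)) _
  · exact SemiconjBy.list_prod_map _ fun j hj =>
      flip_semiconj_zero_succ (h1 j (List.mem_reverse.mp hj)) _
  · refine SemiconjBy.list_prod_map _ fun k hk => Commute.symm ?_
    rw [List.mem_reverse] at hk
    refine SemiconjBy.list_prod_map _ fun j hj => ?_
    exact commute_leg₂_leg₂ (n0 j) (n0 i) (ne (h12 j hj k hk).symm) (ne (h1 k hk)) _ _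
  · refine SemiconjBy.list_prod_map _ fun k hk => ?_
    rw [List.mem_reverse] at hk
    exact commute_leg_leg₂ (n0 i).symm (ne (h1 k hk).symm) _ _
  · refine SemiconjBy.list_prod_map _ fun k hk => Commute.symm ?_
    rw [List.mem_reverse] at hk
    refine SemiconjBy.list_prod_map _ fun j hj => ?_
    rw [List.mem_reverse] at hj
    exact commute_leg₂_leg₂ (n0 i) (n0 j) (ne (h1 k hk)) (ne (h12 j hj k hk).symm) _ _
  · exact SemiconjBy.list_prod_map _ fun k hk => commute_leg_leg₂ (n0 i) (n0 k) _ _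
  · refine prod_mul_mul_prod_reverse hn hY fun j hj k hk hjk => ?_
    exact commute_leg₂_leg₂ (ne (h1 j hj)) (ne hjk) (n0 i) (n0 k) _ _

/-- Evaluation of the trace over the auxiliary factor when the monodromy on the left degenerates
to a flip. -/
theorem trZero_flip_left {i : Fin N} {L₁ L₂ : List (Fin N)} (hL : (L₁ ++ i :: L₂).Nodup)
    {A B K : Matrix ι ι ℂ} {Q : Matrix (ι × ι) (ι × ι) ℂ}
    {U W : Fin N → Matrix (ι × ι) (ι × ι) ℂ}
    (hA : trFst ((A ⊗ₖ (1 : Matrix ι ι ℂ)) * (flip * Q)) = B)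
    (hY : ∀ j ∈ L₁, leg₂ i.succ j.succ (U j) * leg₂ 0 i.succ Q * leg₂ 0 j.succ (W j) =
      leg₂ 0 j.succ (W j) * leg₂ 0 i.succ Q * leg₂ i.succ (j.succ : Fin (N + 1)) (U j)) :
    trZero (leg 0 A * ((L₁.map fun j => leg₂ 0 j.succ (U j)).prod *
        (leg₂ 0 i.succ flip * (L₂.map fun j => leg₂ 0 j.succ (U j)).prod)) * leg 0 K *
        ((L₂.reverse.map fun j => leg₂ 0 j.succ (W j)).prod * (leg₂ 0 i.succ Q *
          (L₁.reverse.map fun j => leg₂ 0 j.succ (W j)).prod))) =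
      (L₂.map fun j => leg₂ i j (U j)).prod * leg i K *
        (L₂.reverse.map fun j => leg₂ i j (W j)).prod *
        (L₁.reverse.map fun j => leg₂ i j (W j)).prod * leg i B *
        (L₁.map fun j => leg₂ i j (U j)).prod := by
  have h1 : ∀ j ∈ L₁, j ≠ i := by grind
  have h2 : ∀ j ∈ L₂, j ≠ i := by grind
  have h12 : ∀ j ∈ L₂, ∀ k ∈ L₁, j ≠ k := by grind
  have hn : L₁.Nodup := by grind
  have ne : ∀ {j k : Fin N}, j ≠ k → j.succ ≠ k.succ := fun h h' => h (Fin.succ_injective _ h')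
  have n0 : ∀ j : Fin N, (0 : Fin (N + 1)) ≠ j.succ := fun j => (Fin.succ_ne_zero j).symm
  have hs : Function.Injective (Fin.succ : Fin N → Fin (N + 1)) := Fin.succ_injective N
  have comm : ∀ (X Y : Fin N → Matrix (ι × ι) (ι × ι) ℂ) (L : List (Fin N)), (∀ j ∈ L, j ∈ L₂) →
      Commute (L.map fun j => leg₂ i.succ j.succ (X j)).prod
        (L₁.map fun j => leg₂ 0 j.succ (Y j)).prod := by
    intro X Y L hLL
    refine SemiconjBy.list_prod_map _ fun k hk => Commute.symm ?_
    refine SemiconjBy.list_prod_map _ fun j hj => ?_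
    exact commute_leg₂_leg₂ (n0 i) (n0 j) (ne (h1 k hk)) (ne (h12 j (hLL j hj) k hk).symm) _ _
  have comm0 : ∀ (X : Fin N → Matrix (ι × ι) (ι × ι) ℂ) (L : List (Fin N)),
      Commute (leg 0 A) (L.map fun j => leg₂ i.succ j.succ (X j)).prod := fun X L =>
    SemiconjBy.list_prod_map _ fun k _ => commute_leg_leg₂ (n0 i) (n0 k) _ _
  rw [reorder_of_semiconj_flip'
    (A' := (L₁.map fun j => leg₂ i.succ j.succ (U j)).prod)
    (B' := (L₂.map fun j => leg₂ i.succ j.succ (U j)).prod)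
    (k' := leg i.succ K) (C' := (L₂.reverse.map fun j => leg₂ i.succ j.succ (W j)).prod)
    (D' := (L₁.reverse.map fun j => leg₂ i.succ j.succ (W j)).prod)]
  · have e1 : ∀ (X : Fin N → Matrix (ι × ι) (ι × ι) ℂ) (L : List (Fin N)),
        (L.map fun j => leg₂ i.succ j.succ (X j)).prod =
          embed Fin.succ (L.map fun j => leg₂ i j (X j)).prod := fun X L => by
      simp only [embed_list_prod hs, embed_leg₂ hs]
    rw [e1, e1, e1, e1, ← embed_leg hs,
      ← embed_mul hs, ← embed_mul hs, ← embed_mul hs, trZero_mul_embed, trZero_embed_mul,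
      trZero_leg_mul_flip_mul, hA]
  · exact SemiconjBy.list_prod_map _ fun j hj => flip_semiconj_succ_succ (h1 j hj) _
  · exact SemiconjBy.list_prod_map _ fun j hj => flip_semiconj_zero_succ (h2 j hj) _
  · exact leg₂_flip_semiconj_leg' (n0 i) K
  · exact SemiconjBy.list_prod_map _ fun j hj =>
      flip_semiconj_zero_succ (h2 j (List.mem_reverse.mp hj)) _
  · exact SemiconjBy.list_prod_map _ fun j hj =>
      flip_semiconj_zero_succ (h1 j (List.mem_reverse.mp hj)) _
  · exact comm U U L₂ fun _ h => h
  · refine SemiconjBy.list_prod_map _ fun k hk => ?_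
    exact commute_leg_leg₂ (n0 i).symm (ne (h1 k hk).symm) _ _
  · exact comm W U _ fun _ h => List.mem_reverse.mp h
  · exact comm0 U L₂
  · exact commute_leg_leg (n0 i) _ _
  · exact comm0 W _
  · exact comm0 W _
  · refine prod_mul_mul_prod_reverse hn hY fun j hj k hk hjk => ?_
    exact commute_leg₂_leg₂ (n0 i).symm (ne (h1 k hk).symm) (n0 j).symm (ne hjk) _ _

end Trace

theorem MerMatrix.generic_analyticAt {α : Type*} [Finite α] {X : ℂ → Matrix α α ℂ}
    (hX : MerMatrix X) :
    Generic Set.univ fun x => ∀ a b, AnalyticAt ℂ (fun x => X x a b) x :=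
  Generic.forall_finite fun a => Generic.forall_finite fun b =>
    Generic.of_eventually_punctured fun w _ => (hX a b w trivial).eventually_analyticAt

theorem continuousAt_of_analyticAt_entries {α : Type*} {X : ℂ → Matrix α α ℂ} {x : ℂ}
    (h : ∀ a b, AnalyticAt ℂ (fun x => X x a b) x) : ContinuousAt X x :=
  continuousAt_pi.mpr fun a => continuousAt_pi.mpr fun b => (h a b).continuousAt

theorem mul_eq_smul_one_comm {α : Type*} [Fintype α] [DecidableEq α] {X Y : Matrix α α ℂ} {c : ℂ}
    (hc : c ≠ 0) (h : X * Y = c • 1) : Y * X = c • 1 := by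
  have h1 : X * (c⁻¹ • Y) = 1 := by rw [mul_smul_comm, h, smul_smul, inv_mul_cancel₀ hc, one_smul]
  have h2 := mul_eq_one_comm.mp h1
  rw [smul_mul_assoc] at h2
  rw [← h2, smul_smul, mul_inv_cancel₀ hc, one_smul]

/-! ### Unitarity of `R` from Yang–Baxter and regularity. -/

section Unitarity

variable {ι : Type*} [Fintype ι] [DecidableEq ι]

theorem continuous_leg₂ {I : Type*} [Fintype I] [DecidableEq I] (i j : I) :
    Continuous (leg₂ i j : Matrix (ι × ι) (ι × ι) ℂ → Matrix (I → ι) (I → ι) ℂ) := by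
  refine continuous_matrix fun a b => ?_
  unfold leg₂
  split_ifs
  · exact continuous_id.matrix_elem _ _
  · exact continuous_const

/-- The Yang–Baxter equation at the point `(x, y)`. -/
def YangBaxterAt (R : ℂ → Matrix (ι × ι) (ι × ι) ℂ) (q : ℂ × ℂ) : Prop :=
  leg₂ (0 : Fin 3) 1 (R (q.1 / q.2)) * leg₂ (0 : Fin 3) 2 (R q.1) * leg₂ (1 : Fin 3) 2 (R q.2) =
    leg₂ (1 : Fin 3) 2 (R q.2) * leg₂ (0 : Fin 3) 2 (R q.1) * leg₂ (0 : Fin 3) 1 (R (q.1 / q.2))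

theorem YangBaxterAt.legs {R : ℂ → Matrix (ι × ι) (ι × ι) ℂ} {x y t : ℂ}
    (h : YangBaxterAt R (x, y)) (ht : x / y = t) {I : Type*} [Fintype I] [DecidableEq I] {a b c : I}
    (hab : a ≠ b) (hac : a ≠ c) (hbc : b ≠ c) :
    leg₂ a b (R t) * leg₂ a c (R x) * leg₂ b c (R y) =
      leg₂ b c (R y) * leg₂ a c (R x) * leg₂ a b (R t) := by
  have hf := injective_triple hab hac hbc
  have := congrArg (embed ![a, b, c]) h
  simpa [embed_mul hf, embed_leg₂ hf, ht] using this

/-- At a regular point the Yang–Baxter equation degenerates to a relation between two products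
acting in different pairs of tensor factors. -/
theorem YangBaxter.mul_swap_eq {R : ℂ → Matrix (ι × ι) (ι × ι) ℂ} (hYBE : YangBaxter R)
    (hreg : Regular R) {y : ℂ} (hy0 : y ≠ 0) (hy : ∀ a b, AnalyticAt ℂ (fun x => R x a b) y)
    (hy' : ∀ a b, AnalyticAt ℂ (fun x => R x a b) y⁻¹) :
    leg₂ (0 : Fin 3) 1 (R y⁻¹ * (R y).submatrix Prod.swap Prod.swap) =
      leg₂ (1 : Fin 3) 2 (R y * (R y⁻¹).submatrix Prod.swap Prod.swap) := by
  obtain ⟨han, ρ, hρ, hR1⟩ := hreg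
  have c0 : ContinuousAt (fun q : ℂ × ℂ => R (q.1 / q.2)) (1, y) := by
    have h1 : ContinuousAt (fun q : ℂ × ℂ => q.1 / q.2) (1, y) :=
      continuousAt_fst.div continuousAt_snd hy0
    have h2 : ContinuousAt R ((1 : ℂ) / y) := by
      rw [one_div]
      exact continuousAt_of_analyticAt_entries hy'
    exact ContinuousAt.comp (f := fun q : ℂ × ℂ => q.1 / q.2) h2 h1
  have c1 : ContinuousAt (fun q : ℂ × ℂ => R q.1) (1, y) :=
    ContinuousAt.comp (f := fun q : ℂ × ℂ => q.1) (x := ((1 : ℂ), y))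
      (continuousAt_of_analyticAt_entries han) continuousAt_fst
  have c2 : ContinuousAt (fun q : ℂ × ℂ => R q.2) (1, y) :=
    ContinuousAt.comp (f := fun q : ℂ × ℂ => q.2) (x := ((1 : ℂ), y))
      (continuousAt_of_analyticAt_entries hy) continuousAt_snd
  have d0 := (continuous_leg₂ (ι := ι) (0 : Fin 3) 1).continuousAt.comp c0
  have d1 := (continuous_leg₂ (ι := ι) (0 : Fin 3) 2).continuousAt.comp c1
  have d2 := (continuous_leg₂ (ι := ι) (1 : Fin 3) 2).continuousAt.comp c2
  -- The line of points `(1, y)` is itself thin, so the generic Yang–Baxter equation reaches it only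
  -- by continuity of the three factors.
  have key := Generic.eq_of_continuousAt hYBE (w := ((1 : ℂ), y)) ⟨one_ne_zero, hy0⟩
    ((d0.mul d1).mul d2) ((d2.mul d1).mul d0)
  simp only [hR1, leg₂_smul, mul_smul_comm, smul_mul_assoc, one_div] at key
  have key' := smul_right_injective _ hρ key
  set P := leg₂ (0 : Fin 3) 2 (flip : Matrix (ι × ι) (ι × ι) ℂ)
  have p1 : P * leg₂ 1 2 (R y) = leg₂ 1 0 (R y) * P :=
    leg₂_flip_semiconj (by decide : (0 : Fin 3) ≠ 2) 1 2 (R y)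
  have p2 : P * leg₂ 0 1 (R y⁻¹) = leg₂ 2 1 (R y⁻¹) * P :=
    leg₂_flip_semiconj (by decide : (0 : Fin 3) ≠ 2) 0 1 (R y⁻¹)
  have pp : P * P = 1 := leg₂_flip_mul_self (by decide : (0 : Fin 3) ≠ 2)
  rw [mul_assoc, p1, mul_assoc, p2, ← mul_assoc, ← mul_assoc] at key'
  have := congrArg (· * P) key'
  simp only [mul_assoc, pp, mul_one] at this
  rw [← leg₂_mul (by decide), ← leg₂_mul (by decide), ← leg₂_swap, ← leg₂_swap]
  exact this

/-- By `h1`, `A` acts trivially in its second factor, since the other side does not touch the last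
of the three. By `h2` it acts trivially in its first factor. Hence it is scalar, read off at the
basis index `o`. -/
theorem eq_smul_one_of_leg₂_eq {A B : Matrix (ι × ι) (ι × ι) ℂ} (o : ι)
    (h1 : leg₂ (0 : Fin 3) 1 B = leg₂ (1 : Fin 3) 2 A)
    (h2 : leg₂ (0 : Fin 3) 1 A = leg₂ (1 : Fin 3) 2 B) : A = A (o, o) (o, o) • 1 := by
  have k1 : ∀ p q p' q', A (p, q) (p', q') = if q = q' then B (o, p) (o, p') else 0 := by
    intro p q p' q'
    have := congrFun (congrFun h1 ![o, p, q]) ![o, p', q']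
    simpa [leg₂, Fin.forall_fin_succ] using this.symm
  have k2 : ∀ p q p' q', A (p, q) (p', q') = if p = p' then B (q, o) (q', o) else 0 := by
    intro p q p' q'
    have := congrFun (congrFun h2 ![p, q, o]) ![p', q', o]
    simpa [leg₂, Fin.forall_fin_succ] using this
  ext ⟨p, q⟩ ⟨p', q'⟩
  rw [Matrix.smul_apply, Matrix.one_apply]
  by_cases hp : p = p'
  · by_cases hq : q = q'
    · subst hp hq
      have e1 : A (p, q) (p, q) = A (p, o) (p, o) := by rw [k1, k1, if_pos rfl, if_pos rfl]
      have e2 : A (p, o) (p, o) = A (o, o) (o, o) := by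
        rw [k2 p, k2 o, if_pos rfl, if_pos rfl]
      simp [e1, e2]
    · rw [k1, if_neg hq, if_neg fun h => hq (Prod.ext_iff.mp h).2, smul_zero]
  · rw [k2, if_neg hp, if_neg fun h => hp (Prod.ext_iff.mp h).1, smul_zero]

/-- The scalar `c(x)` in the unitarity relation `R₁₂(x) R₂₁(x⁻¹) = c(x)`. -/
noncomputable def unitarityFactor [Nonempty ι] (R : ℂ → Matrix (ι × ι) (ι × ι) ℂ) (x : ℂ) : ℂ :=
  (R x * (R x⁻¹).submatrix Prod.swap Prod.swap)
    (Classical.arbitrary ι, Classical.arbitrary ι) (Classical.arbitrary ι, Classical.arbitrary ι)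

/-- Points at which `R` and `R^{t₁}` are invertible and `R` satisfies the unitarity relation. -/
structure IsUnitaryAt [Nonempty ι] (R : ℂ → Matrix (ι × ι) (ι × ι) ℂ) (x : ℂ) : Prop where
  isUnit : IsUnit (R x)
  isUnit_transposeFst : IsUnit (transposeFst (R x))
  mul_swap : R x * (R x⁻¹).submatrix Prod.swap Prod.swap = unitarityFactor R x • 1
  factor_ne_zero : unitarityFactor R x ≠ 0

namespace IsUnitaryAt

variable [Nonempty ι] {R : ℂ → Matrix (ι × ι) (ι × ι) ℂ} {x y : ℂ}
variable {I : Type*} [Fintype I] [DecidableEq I]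

theorem leg₂_mul_leg₂ (h : IsUnitaryAt R x) (hy : x⁻¹ = y) {i j : I} (hij : i ≠ j) :
    leg₂ i j (R x) * leg₂ j i (R y) = unitarityFactor R x • 1 := by
  rw [leg₂_swap i j (R y), leg₂_mul hij, ← hy, h.mul_swap, leg₂_smul, leg₂_one]

theorem leg₂_inv (h : IsUnitaryAt R x) (hy : x⁻¹ = y) (i j : I) :
    leg₂ i j (R x)⁻¹ = (unitarityFactor R x)⁻¹ • leg₂ j i (R y) := by
  have : (R x)⁻¹ = (unitarityFactor R x)⁻¹ • (R x⁻¹).submatrix Prod.swap Prod.swap := by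
    refine Matrix.inv_eq_right_inv ?_
    rw [mul_smul_comm, h.mul_swap, smul_smul, inv_mul_cancel₀ h.factor_ne_zero, one_smul]
  rw [this, leg₂_smul, leg₂_swap i j (R y), hy]

theorem leg₂_mul_leg₂_inv (h : IsUnitaryAt R x) {i j : I} (hij : i ≠ j) :
    leg₂ i j (R x) * leg₂ i j (R x)⁻¹ = 1 := by
  rw [leg₂_mul hij, Matrix.mul_nonsing_inv _ ((Matrix.isUnit_iff_isUnit_det _).mp h.isUnit),
    leg₂_one]

end IsUnitaryAt

theorem generic_isUnitaryAt [Nonempty ι] {R : ℂ → Matrix (ι × ι) (ι × ι) ℂ} (hR : MerMatrix R)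
    (hRinv : GenericallyInvertible R) (hRt : GenericallyInvertible fun x => transposeFst (R x))
    (hYBE : YangBaxter R) (hreg : Regular R) :
    Generic {x : ℂ | x ≠ 0} (IsUnitaryAt R) := by
  have hopen : IsOpen {x : ℂ | x ≠ 0} := isOpen_ne
  have han := hR.generic_analyticAt.mono_set (Set.subset_univ {x : ℂ | x ≠ 0})
  have hu := Generic.mono_set hRinv (Set.subset_univ {x : ℂ | x ≠ 0})
  have ht := Generic.mono_set hRt (Set.subset_univ {x : ℂ | x ≠ 0})
  refine ((Generic.of_forall_mem hopen fun x hx => hx).and ((han.and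
    (han.comp isOpenAnalytic_inv)).and ((hu.and (hu.comp isOpenAnalytic_inv)).and ht))).mono ?_
  rintro x ⟨hx0, ⟨ha, ha'⟩, ⟨hx, hx'⟩, hxt⟩
  have e1 := hYBE.mul_swap_eq hreg hx0 ha ha'
  have e2 := hYBE.mul_swap_eq hreg (inv_ne_zero hx0) ha' (by rwa [inv_inv])
  rw [inv_inv] at e2
  have e3 := eq_smul_one_of_leg₂_eq (Classical.arbitrary ι) e1 e2
  refine ⟨hx, hxt, e3, fun h0 => ?_⟩
  -- A zero scalar would make a product of two invertible matrices vanish.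
  have hs : IsUnit ((R x⁻¹).submatrix Prod.swap Prod.swap) :=
    (Matrix.isUnit_submatrix_equiv (A := R x⁻¹) (Equiv.prodComm ι ι) (Equiv.prodComm ι ι)).mpr hx'
  have := hx.mul hs
  rw [e3] at this
  unfold unitarityFactor at h0
  rw [h0, zero_smul] at this
  exact not_isUnit_zero this

theorem meromorphicAt_mul_inv_entry {α : Type*} [Fintype α] {X Y : ℂ → Matrix α α ℂ}
    (hX : MerMatrix X) (hY : MerMatrix Y) (a b : α) {x : ℂ} (hx : x ≠ 0) :
    MeromorphicAt (fun x => (X x * Y x⁻¹) a b) x := by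
  simp only [Matrix.mul_apply]
  refine MeromorphicAt.fun_sum fun c _ => (hX a c x trivial).mul ?_
  exact (hY c b x⁻¹ trivial).comp_analyticAt (g := fun x => x⁻¹) (analyticAt_inv hx)

theorem isMeromorphicUnit_unitarityFactor [Nonempty ι] {R : ℂ → Matrix (ι × ι) (ι × ι) ℂ}
    (hR : MerMatrix R) (h : Generic {x : ℂ | x ≠ 0} (IsUnitaryAt R)) :
    IsMeromorphicUnit {x : ℂ | x ≠ 0} (unitarityFactor R) where
  meromorphic := IsMeromorphicOn.of_meromorphicAt fun _ hx =>
    meromorphicAt_mul_inv_entry (Y := fun x => (R x).submatrix Prod.swap Prod.swap) hR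
      (fun a b => hR a.swap b.swap) _ _ hx
  ne_zero := h.mono fun _ hx => hx.factor_ne_zero

/-- The scalar in the boundary unitarity relation `K(x) K(x⁻¹) = d(x)`. -/
noncomputable def boundaryFactor [Nonempty ι] (K : ℂ → Matrix ι ι ℂ) (x : ℂ) : ℂ :=
  (K x * K x⁻¹) (Classical.arbitrary ι) (Classical.arbitrary ι)

/-- The hypothesis supplies a scalar point by point; reading it off as a diagonal entry gives a
choice that is meromorphic in `x`. -/
theorem BoundaryUnitary.generic_mul [Nonempty ι] {K : ℂ → Matrix ι ι ℂ} (h : BoundaryUnitary K) :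
    Generic {x : ℂ | x ≠ 0} fun x =>
      K x * K x⁻¹ = boundaryFactor K x • 1 ∧ boundaryFactor K x ≠ 0 := by
  refine Generic.mono h ?_
  rintro x ⟨c, hc, hx⟩
  have : boundaryFactor K x = c := by simp [boundaryFactor, hx]
  exact ⟨by rw [this, hx], by rwa [this]⟩

theorem BoundaryUnitary.isMeromorphicUnit [Nonempty ι] {K : ℂ → Matrix ι ι ℂ}
    (h : BoundaryUnitary K) (hK : MerMatrix K) :
    IsMeromorphicUnit {x : ℂ | x ≠ 0} (boundaryFactor K) where
  meromorphic := IsMeromorphicOn.of_meromorphicAt fun _ hx =>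
    meromorphicAt_mul_inv_entry hK hK _ _ hx
  ne_zero := h.generic_mul.mono fun _ hx => hx.2

end Unitarity

/-! ### Scalars in ordered products, and splitting the chain at sites. -/

section Lists

theorem prod_map_smul {A κ : Type*} [Ring A] [Algebra ℂ A] (s : κ → ℂ) (f : κ → A) (L : List κ) :
    (L.map fun j => s j • f j).prod = (L.map s).prod • (L.map f).prod := by
  induction L with
  | nil => simp
  | cons j L ih =>
    simp only [List.map_cons, List.prod_cons]
    rw [ih, smul_mul_smul_comm]

theorem prod_map_mul_prod_map_reverse {A κ : Type*} [Ring A] [Algebra ℂ A] {s : κ → ℂ}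
    {f g : κ → A} {L : List κ} (h : ∀ j ∈ L, f j * g j = s j • 1) :
    (L.map f).prod * (L.reverse.map g).prod = (L.map s).prod • 1 := by
  induction L with
  | nil => simp
  | cons j L ih =>
    have ih' := ih fun k hk => h k (by simp [hk])
    simp only [List.map_cons, List.prod_cons, List.reverse_cons, List.map_append, List.prod_append,
      List.map_nil, List.prod_nil, mul_one]
    calc f j * (L.map f).prod * ((L.reverse.map g).prod * g j)
        = f j * ((L.map f).prod * (L.reverse.map g).prod) * g j := by simp only [mul_assoc]
      _ = _ := by
        rw [ih', mul_smul_comm, mul_one, smul_mul_assoc, h j (by simp), smul_smul, mul_comm]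

theorem filter_of_sorted_append {κ : Type*} [LinearOrder κ] {l L₁ L₂ : List κ} {i : κ}
    (hl : l.Pairwise (· < ·)) (h : l = L₁ ++ i :: L₂) :
    l.filter (fun j => j < i) = L₁ ∧ l.filter (fun j => i < j) = L₂ := by
  subst h
  rw [List.pairwise_append, List.pairwise_cons] at hl
  obtain ⟨-, ⟨h1, -⟩, h2⟩ := hl
  have a1 : ∀ j ∈ L₁, j < i := fun j hj => h2 j hj i (by simp)
  constructor
  · rw [List.filter_append, List.filter_cons_of_neg (by simp), List.filter_eq_self.mpr,
      List.filter_eq_nil_iff.mpr, List.append_nil]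
    · intro j hj
      simpa using (h1 j hj).le
    · intro j hj
      simpa using a1 j hj
  · rw [List.filter_append, List.filter_cons_of_neg (by simp), List.filter_eq_nil_iff.mpr,
      List.filter_eq_self.mpr, List.nil_append]
    · intro j hj
      simpa using h1 j hj
    · intro j hj
      simpa using (a1 j hj).le

/-- The sites before `i`. -/
def sitesBefore {N : ℕ} (i : Fin N) : List (Fin N) := (List.finRange N).filter fun j => j < i

/-- The sites after `i`. -/
def sitesAfter {N : ℕ} (i : Fin N) : List (Fin N) := (List.finRange N).filter fun j => i < j

theorem finRange_eq_append {N : ℕ} (i : Fin N) :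
    List.finRange N = sitesBefore i ++ i :: sitesAfter i := by
  obtain ⟨s, t, h⟩ := List.append_of_mem (List.mem_finRange i)
  obtain ⟨h1, h2⟩ := filter_of_sorted_append (List.pairwise_lt_finRange N) h
  rw [sitesBefore, sitesAfter, h1, h2, h]

theorem nodup_sites {N : ℕ} (i : Fin N) : (sitesBefore i ++ i :: sitesAfter i).Nodup := by
  rw [← finRange_eq_append]
  exact List.nodup_finRange N

theorem exists_sites_of_lt {N : ℕ} {i j : Fin N} (hij : i < j) :
    ∃ L₁ L₂ L₃, (L₁ ++ i :: (L₂ ++ j :: L₃)).Nodup ∧ sitesBefore i = L₁ ∧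
      sitesAfter i = L₂ ++ j :: L₃ ∧ sitesBefore j = L₁ ++ i :: L₂ ∧ sitesAfter j = L₃ := by
  have hj : j ∈ sitesAfter i := by simp [sitesAfter, hij]
  obtain ⟨L₂, L₃, h⟩ := List.append_of_mem hj
  have h0 := finRange_eq_append i
  rw [h] at h0
  refine ⟨sitesBefore i, L₂, L₃, h0 ▸ List.nodup_finRange N, rfl, h, ?_⟩
  exact filter_of_sorted_append (List.pairwise_lt_finRange N) (by rw [h0]; simp)

end Lists

/-! ### Identities at a regular point of the torus. -/

section RegularPoints

variable {ι : Type*} [Fintype ι] [DecidableEq ι] [Nonempty ι] {N : ℕ}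

/-- The left reflection equation at the point `(x, y)`. -/
def LeftReflectionAt (R : ℂ → Matrix (ι × ι) (ι × ι) ℂ) (K : ℂ → Matrix ι ι ℂ) (q : ℂ × ℂ) :
    Prop :=
  leg₂ (0 : Fin 2) 1 (R (q.1 / q.2)) * leg (0 : Fin 2) (K q.1) *
      leg₂ (1 : Fin 2) 0 (R (q.1 * q.2)) * leg (1 : Fin 2) (K q.2) =
    leg (1 : Fin 2) (K q.2) * leg₂ (0 : Fin 2) 1 (R (q.1 * q.2)) *
      leg (0 : Fin 2) (K q.1) * leg₂ (1 : Fin 2) 0 (R (q.1 / q.2))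

/-- The right reflection equation at the point `(x, y)`. -/
def RightReflectionAt (R : ℂ → Matrix (ι × ι) (ι × ι) ℂ) (K : ℂ → Matrix ι ι ℂ) (q : ℂ × ℂ) :
    Prop :=
  leg₂ (1 : Fin 2) 0 (R (q.1 / q.2)) * leg (0 : Fin 2) (K q.1) *
      leg₂ (0 : Fin 2) 1 (R (q.1 * q.2)) * leg (1 : Fin 2) (K q.2) =
    leg (1 : Fin 2) (K q.2) * leg₂ (1 : Fin 2) 0 (R (q.1 * q.2)) *
      leg (0 : Fin 2) (K q.1) * leg₂ (0 : Fin 2) 1 (R (q.1 / q.2))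

/-- Points `z` at which all the relations between the operators `R_{ij}(z_i^{±1} z_j^{±1})` used
below hold. -/
structure IsRegularPoint (R : ℂ → Matrix (ι × ι) (ι × ι) ℂ) (z : Fin N → ℂ) : Prop where
  ne_zero : ∀ i, z i ≠ 0
  unitary_div : ∀ i j, i ≠ j → IsUnitaryAt R (z i / z j)
  unitary_mul : ∀ i j, IsUnitaryAt R (z i * z j)
  unitary_inv_mul : ∀ i j, IsUnitaryAt R (z i * z j)⁻¹
  braid_div : ∀ a b c, a ≠ b ∧ a ≠ c ∧ b ≠ c → YangBaxterAt R (z a / z c, z b / z c)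
  braid_mul : ∀ a b c, a ≠ b ∧ a ≠ c ∧ b ≠ c → YangBaxterAt R (z a * z c, z b * z c)
  braid_mul_div : ∀ a b c, a ≠ b ∧ a ≠ c ∧ b ≠ c → YangBaxterAt R (z a * z c, z c / z b)
  braid_sq : ∀ i j, i ≠ j → YangBaxterAt R (z i ^ 2, z i * z j)
  braid_inv_sq : ∀ i j, i ≠ j → YangBaxterAt R ((z i)⁻¹ ^ 2, (z i)⁻¹ * z j)

/-- The diagonal case is the squaring map; it is needed for `R(z_i²)`, which enters through `K'`. -/
theorem isOpenAnalytic_mul_eval (i j : Fin N) :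
    IsOpenAnalytic (torus N) {x : ℂ | x ≠ 0} (fun z => z i * z j) := by
  by_cases hij : i = j
  · subst hij
    simp only [← pow_two]
    exact isOpenAnalytic_pow_two.comp (isOpenAnalytic_eval i)
  · exact isOpenAnalytic_mul.comp (isOpenAnalytic_eval_pair hij)

theorem generic_isRegularPoint {R : ℂ → Matrix (ι × ι) (ι × ι) ℂ} (hYBE : YangBaxter R)
    (hU : Generic {x : ℂ | x ≠ 0} (IsUnitaryAt R)) : Generic (torus N) (IsRegularPoint R) := by
  have h0 : Generic (torus N) fun z => ∀ i, z i ≠ 0 :=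
    Generic.of_forall_mem isOpen_torus fun z hz => hz
  have h1 : Generic (torus N) fun z => ∀ i j, i ≠ j → IsUnitaryAt R (z i / z j) :=
    Generic.forall_finite fun i => Generic.forall_finite fun j => Generic.imp fun hij =>
      hU.comp (isOpenAnalytic_div.comp (isOpenAnalytic_eval_pair hij))
  have h2 : Generic (torus N) fun z => ∀ i j, IsUnitaryAt R (z i * z j) :=
    Generic.forall_finite fun i => Generic.forall_finite fun j =>
      hU.comp (isOpenAnalytic_mul_eval i j)
  have h3 : Generic (torus N) fun z => ∀ i j, IsUnitaryAt R (z i * z j)⁻¹ :=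
    Generic.forall_finite fun i => Generic.forall_finite fun j =>
      hU.comp (isOpenAnalytic_inv.comp (isOpenAnalytic_mul_eval i j))
  have h4 : Generic (torus N) fun z => ∀ a b c, a ≠ b ∧ a ≠ c ∧ b ≠ c →
      YangBaxterAt R (z a / z c, z b / z c) :=
    Generic.forall_finite fun a => Generic.forall_finite fun b => Generic.forall_finite fun c =>
      Generic.imp fun h => Generic.comp (P := YangBaxterAt R) hYBE
        (isOpenAnalytic_div_div h.1 h.2.1 h.2.2)
  have h5 : Generic (torus N) fun z => ∀ a b c, a ≠ b ∧ a ≠ c ∧ b ≠ c →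
      YangBaxterAt R (z a * z c, z b * z c) :=
    Generic.forall_finite fun a => Generic.forall_finite fun b => Generic.forall_finite fun c =>
      Generic.imp fun h => Generic.comp (P := YangBaxterAt R) hYBE
        (isOpenAnalytic_mul_mul h.1 h.2.1 h.2.2)
  have h6 : Generic (torus N) fun z => ∀ a b c, a ≠ b ∧ a ≠ c ∧ b ≠ c →
      YangBaxterAt R (z a * z c, z c / z b) :=
    Generic.forall_finite fun a => Generic.forall_finite fun b => Generic.forall_finite fun c =>
      Generic.imp fun h => Generic.comp (P := YangBaxterAt R) hYBE
        (isOpenAnalytic_mul_div h.1 h.2.1 h.2.2)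
  have h7 : Generic (torus N) fun z => ∀ i j, i ≠ j → YangBaxterAt R (z i ^ 2, z i * z j) :=
    Generic.forall_finite fun i => Generic.forall_finite fun j => Generic.imp fun hij =>
      Generic.comp (P := YangBaxterAt R) hYBE
        (isOpenAnalytic_sq_mul.comp (isOpenAnalytic_eval_pair hij))
  have h8 : Generic (torus N) fun z => ∀ i j, i ≠ j →
      YangBaxterAt R ((z i)⁻¹ ^ 2, (z i)⁻¹ * z j) :=
    Generic.forall_finite fun i => Generic.forall_finite fun j => Generic.imp fun hij =>
      Generic.comp (P := YangBaxterAt R) hYBE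
        (isOpenAnalytic_sq_mul.comp (isOpenAnalytic_inv_fst.comp (isOpenAnalytic_eval_pair hij)))
  refine (h0.and (h1.and (h2.and (h3.and (h4.and (h5.and (h6.and (h7.and h8)))))))).mono ?_
  rintro z ⟨k0, k1, k2, k3, k4, k5, k6, k7, k8⟩
  exact ⟨k0, k1, k2, k3, k4, k5, k6, k7, k8⟩

/-- The operator `R_{ij}(z_i z_j)`. -/
noncomputable def mulLeg (R : ℂ → Matrix (ι × ι) (ι × ι) ℂ) (z : Fin N → ℂ) (i j : Fin N) :
    Matrix (Fin N → ι) (Fin N → ι) ℂ := leg₂ i j (R (z i * z j))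

/-- The operator `R_{ij}(z_i / z_j)`. -/
noncomputable def divLeg (R : ℂ → Matrix (ι × ι) (ι × ι) ℂ) (z : Fin N → ℂ) (i j : Fin N) :
    Matrix (Fin N → ι) (Fin N → ι) ℂ := leg₂ i j (R (z i / z j))

/-- The transport operator at `p = 1` with `R_{ji}(z_j / z_i)⁻¹` replaced by `R_{ij}(z_i / z_j)`. -/
noncomputable def boundaryChain (R : ℂ → Matrix (ι × ι) (ι × ι) ℂ) (Kp Km : ℂ → Matrix ι ι ℂ) (z : Fin N → ℂ)
    (i : Fin N) : Matrix (Fin N → ι) (Fin N → ι) ℂ :=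
  chainOperator (mulLeg R z) (divLeg R z) (fun a => leg a (Kp (z a))) (fun a => leg a (Km (z a))) i
    (sitesBefore i) (sitesAfter i)

/-- A multiple of the inverse of `boundaryChain`. -/
noncomputable def inverseBoundaryChain (R : ℂ → Matrix (ι × ι) (ι × ι) ℂ) (Kp Km : ℂ → Matrix ι ι ℂ)
    (z : Fin N → ℂ) (i : Fin N) : Matrix (Fin N → ι) (Fin N → ι) ℂ :=
  ((sitesAfter i).map fun j => leg₂ i j (R (z i / z j))⁻¹).prod * leg i (Km (z i)⁻¹) *
    ((sitesAfter i).reverse.map fun j => leg₂ i j (R ((z i)⁻¹ / z j))).prod *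
    ((sitesBefore i).reverse.map fun j => leg₂ i j (R ((z i)⁻¹ / z j))).prod *
    leg i (Kp (z i)⁻¹) * ((sitesBefore i).map fun j => leg₂ i j (R (z i / z j))⁻¹).prod

namespace IsRegularPoint

variable {R : ℂ → Matrix (ι × ι) (ι × ι) ℂ} {Kp Km : ℂ → Matrix ι ι ℂ} {z : Fin N → ℂ} {ρ : ℂ}

/-- Unitarity replaces each `R_{0j}(1/(z_i z_j))⁻¹` by a multiple of `R_{j0}(z_j z_i)`. The case `j
= i` supplies the factor `R_{i0}(z_i²)` that turns `K'` into `K⁺`. -/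
theorem transferMatrix_eq (hz : IsRegularPoint R z) (hR1 : R 1 = ρ • flip) (i : Fin N) :
    transferMatrix R (phi (tilde R) Kp) Km (z i) z =
      (((List.finRange N).map fun j => (unitarityFactor R (z i * z j)⁻¹)⁻¹).prod * ρ) •
        boundaryChain R Kp Km z i := by
  have ne : ∀ {j k : Fin N}, j ≠ k → j.succ ≠ k.succ := fun h h' => h (Fin.succ_injective _ h')
  have e1 : ((List.finRange N).map fun j =>
      leg₂ (0 : Fin (N + 1)) j.succ (R (1 / (z i * z j)))⁻¹).prod =
      ((List.finRange N).map fun j => (unitarityFactor R (z i * z j)⁻¹)⁻¹).prod •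
        ((List.finRange N).map fun j => leg₂ j.succ 0 (R (z j * z i))).prod := by
    rw [← prod_map_smul]
    congr 2
    funext j
    rw [one_div]
    exact (hz.unitary_inv_mul i j).leg₂_inv (by rw [inv_inv, mul_comm]) _ _
  rw [transferMatrix, e1]
  generalize ((List.finRange N).map fun j => (unitarityFactor R (z i * z j)⁻¹)⁻¹).prod = s
  rw [finRange_eq_append i]
  simp only [List.map_append, List.map_cons, List.prod_append, List.prod_cons,
    List.reverse_append, List.reverse_cons, List.map_nil, List.prod_nil, mul_one,
    div_self (hz.ne_zero i), hR1, leg₂_smul, mul_smul_comm, smul_mul_assoc, trZero_smul,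
    smul_smul]
  rw [mul_comm ρ s]
  congr 1
  have hu : IsUnit (transposeFst (R (z i ^ 2))) := by
    rw [pow_two]
    exact (hz.unitary_mul i i).isUnit_transposeFst
  have key := trZero_flip_right (nodup_sites i) (K := Km (z i)) (U := fun j => R (z j * z i))
    (W := fun j => R (z i / z j)) (trFst_phi_tilde R Kp hu) (fun j hj => ?_)
  · rw [pow_two] at key
    rw [boundaryChain, chainOperator]
    simp only [mul_assoc] at key ⊢
    exact key
  · have hij : i ≠ j := by
      rintro rfl
      simp [sitesBefore] at hj
    have hzi := hz.ne_zero i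
    have hzj := hz.ne_zero j
    -- Yang–Baxter in the factors `i`, `j`, 0 at `(z_i², z_i z_j)`, whose ratio is `z_i / z_j`.
    have := (hz.braid_sq i j hij).legs (t := z i / z j) (by field_simp)
      (ne hij) (Fin.succ_ne_zero i) (Fin.succ_ne_zero j)
    rw [mul_comm (z i) (z j)] at this
    exact this.symm

/-- Now the left half contains `R(1)⁻¹ = ρ⁻¹ P`, and the factor that turns `K'` into `K⁺` is
`R_{0i}(z_i⁻²)` from the right half. -/
theorem transferMatrix_inv_eq (hz : IsRegularPoint R z) (hρ : ρ ≠ 0) (hR1 : R 1 = ρ • flip)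
    (i : Fin N) : transferMatrix R (phi (tilde R) Kp) Km (z i)⁻¹ z =
      ρ⁻¹ • inverseBoundaryChain R Kp Km z i := by
  have ne : ∀ {j k : Fin N}, j ≠ k → j.succ ≠ k.succ := fun h h' => h (Fin.succ_injective _ h')
  have hzi := hz.ne_zero i
  have hinv : (R 1)⁻¹ = ρ⁻¹ • flip := by
    refine Matrix.inv_eq_right_inv ?_
    rw [hR1, smul_mul_smul_comm, mul_inv_cancel₀ hρ, flip_mul_flip, one_smul]
  have e0 : ∀ j, 1 / ((z i)⁻¹ * z j) = z i / z j := fun j => by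
    rw [one_div, mul_inv, inv_inv, div_eq_mul_inv]
  rw [transferMatrix, finRange_eq_append i]
  simp only [e0, List.map_append, List.map_cons, List.prod_append, List.prod_cons,
    List.reverse_append, List.reverse_cons, List.map_nil, List.prod_nil, mul_one,
    div_self hzi, hinv, leg₂_smul, mul_smul_comm, smul_mul_assoc, trZero_smul]
  congr 1
  have e2 : (z i)⁻¹ ^ 2 = (z i)⁻¹ / z i := by
    rw [pow_two, div_eq_mul_inv]
  have hu : IsUnit (transposeFst (R ((z i)⁻¹ ^ 2))) := by
    rw [pow_two, ← mul_inv]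
    exact (hz.unitary_inv_mul i i).isUnit_transposeFst
  have key := trZero_flip_left (nodup_sites i) (K := Km (z i)⁻¹) (U := fun j => (R (z i / z j))⁻¹)
    (W := fun j => R ((z i)⁻¹ / z j)) (trFst_phi_tilde R Kp hu) (fun j hj => ?_)
  · rw [e2] at key
    rw [inverseBoundaryChain]
    simp only [mul_assoc] at key ⊢
    exact key
  · have hij : i ≠ j := by
      rintro rfl
      simp [sitesBefore] at hj
    have hzj := hz.ne_zero j
    have := (hz.braid_inv_sq i j hij).legs (t := (z i)⁻¹ / z j) (by field_simp)
      (Fin.succ_ne_zero j).symm (Fin.succ_ne_zero i).symm (ne hij.symm)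
    -- By unitarity `R_{ij}(z_i/z_j)⁻¹` is a multiple of `R_{ji}(z_j/z_i)`; the exchange is then
    -- Yang–Baxter in the factors 0, `j`, `i` at `(z_i⁻², z_j/z_i)`.
    rw [(hz.unitary_div i j hij).leg₂_inv (y := (z i)⁻¹ * z j) (by field_simp)]
    simp only [smul_mul_assoc, mul_smul_comm]
    rw [this]

theorem transportMatrix_eq (hz : IsRegularPoint R z) (i : Fin N) :
    transportMatrix R Kp Km i z 1 =
      ((sitesAfter i).reverse.map fun j => (unitarityFactor R (z j / z i))⁻¹).prod •
        boundaryChain R Kp Km z i := by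
  have e1 : ((sitesAfter i).reverse.map fun j => leg₂ j i (R (z j / z i))⁻¹).prod =
      ((sitesAfter i).reverse.map fun j => (unitarityFactor R (z j / z i))⁻¹).prod •
        ((sitesAfter i).reverse.map (divLeg R z i)).prod := by
    rw [← prod_map_smul]
    refine congrArg List.prod (List.map_congr_left fun j hj => ?_)
    have hij : j ≠ i := by
      rintro rfl
      simp [sitesAfter] at hj
    exact (hz.unitary_div j i hij).leg₂_inv (inv_div _ _) _ _
  simp only [transportMatrix, one_mul, Complex.one_cpow]
  change _ * ((sitesAfter i).reverse.map fun j => leg₂ j i (R (z j / z i))⁻¹).prod = _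
  rw [e1, mul_smul_comm]
  rfl

/-- The two words are mirror images, so they cancel from the middle outwards: quotient factors to 1,
product factors and K-matrices to their unitarity scalars. -/
theorem boundaryChain_mul_inverse (hz : IsRegularPoint R z) {dp dm : ℂ} (i : Fin N)
    (hp : Kp (z i) * Kp (z i)⁻¹ = dp • 1) (hm : Km (z i) * Km (z i)⁻¹ = dm • 1) :
    boundaryChain R Kp Km z i * inverseBoundaryChain R Kp Km z i =
      (((sitesBefore i).map fun j => unitarityFactor R (z j * z i)).prod *
        ((sitesAfter i).map fun j => unitarityFactor R (z j * z i)).prod * (dp * dm)) •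
        (1 : Matrix (Fin N → ι) (Fin N → ι) ℂ) := by
  have n1 : ∀ j ∈ sitesBefore i, i ≠ j := by
    rintro j hj rfl
    simp [sitesBefore] at hj
  have n2 : ∀ j ∈ sitesAfter i, i ≠ j := by
    rintro j hj rfl
    simp [sitesAfter] at hj
  have ediv : ∀ L : List (Fin N), (∀ j ∈ L, i ≠ j) →
      (L.reverse.map (divLeg R z i)).prod * (L.map fun j => leg₂ i j (R (z i / z j))⁻¹).prod =
        1 := by
    intro L hL
    have := prod_map_mul_prod_map_reverse (s := fun _ => 1) (f := divLeg R z i)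
      (g := fun j => leg₂ i j (R (z i / z j))⁻¹) (L := L.reverse) fun j hj => by
        rw [one_smul]
        have hij := hL j (List.mem_reverse.mp hj)
        exact (hz.unitary_div i j hij).leg₂_mul_leg₂_inv hij
    simpa using this
  have emul : ∀ L : List (Fin N), (∀ j ∈ L, i ≠ j) →
      (L.map fun l => mulLeg R z l i).prod *
        (L.reverse.map fun j => leg₂ i j (R ((z i)⁻¹ / z j))).prod =
        (L.map fun j => unitarityFactor R (z j * z i)).prod • 1 := by
    intro L hL
    refine prod_map_mul_prod_map_reverse fun j hj => ?_
    refine (hz.unitary_mul j i).leg₂_mul_leg₂ ?_ (hL j hj).symm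
    rw [mul_inv, div_eq_mul_inv, mul_comm]
  have e1 := mul_right_of_eq (ediv _ n2)
  have e2 := mul_right_of_eq (emul _ n2)
  have e3 := mul_right_of_eq (emul _ n1)
  have e4 := ediv _ n1
  have kp : ∀ x, leg i (Kp (z i)) * (leg i (Kp (z i)⁻¹) * x) = dp • x := fun x => by
    rw [← mul_assoc, leg_mul, hp, leg_smul, leg_one, smul_mul_assoc, one_mul]
  have km : ∀ x, leg i (Km (z i)) * (leg i (Km (z i)⁻¹) * x) = dm • x := fun x => by
    rw [← mul_assoc, leg_mul, hm, leg_smul, leg_one, smul_mul_assoc, one_mul]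
  rw [boundaryChain, inverseBoundaryChain, chainOperator]
  simp only [mul_assoc, smul_mul_assoc, one_mul] at e1 e2 e3 ⊢
  rw [e1, km, mul_smul_comm, mul_smul_comm, mul_smul_comm, mul_smul_comm, e2, mul_smul_comm,
    mul_smul_comm, mul_smul_comm, e3, mul_smul_comm, mul_smul_comm, kp, mul_smul_comm, e4]
  simp only [smul_smul]
  congr 1
  ring

theorem boundaryBraiding (hz : IsRegularPoint R z)
    (hp : ∀ i j, i ≠ j → LeftReflectionAt R Kp (z i, z j))
    (hm : ∀ i j, i ≠ j → RightReflectionAt R Km (z i, z j)) :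
    BoundaryBraiding (mulLeg R z) (divLeg R z) (fun i j => leg₂ i j (R (z j / z i)))
      (fun a => leg a (Kp (z a))) (fun a => leg a (Km (z a))) where
  u_mem i j := leg₂_mem_actsIn (by simp) (by simp) _
  w_mem i j := leg₂_mem_actsIn (by simp) (by simp) _
  p_mem i := leg_mem_actsIn (by simp) _
  m_mem i := leg_mem_actsIn (by simp) _
  braid_w a b c hab hac hbc := by
    have ha := hz.ne_zero a
    have hb := hz.ne_zero b
    have hc := hz.ne_zero c
    exact (hz.braid_div a b c ⟨hab, hac, hbc⟩).legs (by field_simp) hab hac hbc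
  braid_u a b c hab hac hbc := by
    have ha := hz.ne_zero a
    have hb := hz.ne_zero b
    have hc := hz.ne_zero c
    exact (hz.braid_mul a b c ⟨hab, hac, hbc⟩).legs (by field_simp) hab hac hbc
  braid_w' a b c hab hac hbc := by
    have ha := hz.ne_zero a
    have hb := hz.ne_zero b
    have hc := hz.ne_zero c
    -- The primed operator is `R_{bc}(z_c / z_b)`, with the arguments inverted relative to `divLeg`;
    -- hence the mixed point `(z_a z_c, z_c / z_b)`.
    exact ((hz.braid_mul_div a b c ⟨hab, hac, hbc⟩).legs (t := z a * z b) (by field_simp)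
      hab hac hbc).symm
  left i j hij := by
    have hf := injective_pair hij
    have := congrArg (embed ![i, j]) (hp i j hij)
    simpa [embed_mul hf, embed_leg₂ hf, embed_leg hf, mulLeg, divLeg, mul_comm (z j)] using this
  right i j hij := by
    have hf := injective_pair hij
    have := congrArg (embed ![i, j]) (hm i j hij)
    simpa [embed_mul hf, embed_leg₂ hf, embed_leg hf, mulLeg, divLeg, mul_comm (z j)] using this
  unitary i j hij := by
    have hu := hz.unitary_div i j hij
    have h := hu.leg₂_mul_leg₂ (inv_div _ _) hij
    exact ⟨_, h, mul_eq_smul_one_comm hu.factor_ne_zero h⟩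

end IsRegularPoint

end RegularPoints

theorem commute_boundaryChain {ι : Type*} [Fintype ι] [DecidableEq ι] [Nonempty ι] {N : ℕ}
    {R : ℂ → Matrix (ι × ι) (ι × ι) ℂ} {Kp Km : ℂ → Matrix ι ι ℂ} {z : Fin N → ℂ}
    {w' : Fin N → Fin N → Matrix (Fin N → ι) (Fin N → ι) ℂ}
    (h : BoundaryBraiding (mulLeg R z) (divLeg R z) w' (fun a => leg a (Kp (z a)))
      (fun a => leg a (Km (z a)))) (i j : Fin N) :
    Commute (boundaryChain R Kp Km z i) (boundaryChain R Kp Km z j) := by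
  have key : ∀ i j : Fin N, i < j →
      Commute (boundaryChain R Kp Km z i) (boundaryChain R Kp Km z j) := by
    intro i j hij
    obtain ⟨L₁, L₂, L₃, hn, h1, h2, h3, h4⟩ := exists_sites_of_lt hij
    rw [boundaryChain, boundaryChain, h1, h2, h3, h4]
    exact h.commute_chainOperator hn
  rcases lt_trichotomy i j with hij | rfl | hij
  · exact key i j hij
  · exact Commute.refl _
  · exact (key j i hij).symm

theorem commute_of_mul_eq_smul_one {α : Type*} [Fintype α] [DecidableEq α]
    {X B C : Matrix α α ℂ} {c : ℂ} (hc : c ≠ 0) (h : B * C = c • 1) (hX : Commute X B) :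
    Commute X C := by
  have h' := mul_eq_smul_one_comm hc h
  have h1 : c • (X * C) = c • (C * X) := by
    calc c • (X * C) = (C * B) * (X * C) := by rw [h', smul_mul_assoc, one_mul]
      _ = C * (B * X) * C := by simp only [mul_assoc]
      _ = C * X * (B * C) := by rw [← hX.eq]; simp only [mul_assoc]
      _ = c • (C * X) := by rw [h, mul_smul_comm, mul_one]
  exact smul_right_injective _ hc h1

/-! ### Meromorphic factors and the three assertions. -/

section Main

variable {ι : Type*} [Fintype ι] [DecidableEq ι] {N : ℕ}

/-- The factor of proportionality between `𝒯(z_i; z)` and `boundaryChain`. -/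
noncomputable def transferFactor [Nonempty ι] (R : ℂ → Matrix (ι × ι) (ι × ι) ℂ) (ρ : ℂ)
    (i : Fin N) (z : Fin N → ℂ) : ℂ :=
  ((List.finRange N).map fun j => (unitarityFactor R (z i * z j)⁻¹)⁻¹).prod * ρ

/-- The factor of proportionality between `𝒜_i(z; 1)` and `boundaryChain`. -/
noncomputable def transportFactor [Nonempty ι] (R : ℂ → Matrix (ι × ι) (ι × ι) ℂ) (i : Fin N)
    (z : Fin N → ℂ) : ℂ :=
  ((sitesAfter i).reverse.map fun j => (unitarityFactor R (z j / z i))⁻¹).prod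

/-- The product of `boundaryChain` and `inverseBoundaryChain`. -/
noncomputable def chainFactor [Nonempty ι] (R : ℂ → Matrix (ι × ι) (ι × ι) ℂ)
    (Kp Km : ℂ → Matrix ι ι ℂ) (i : Fin N) (z : Fin N → ℂ) : ℂ :=
  ((sitesBefore i).map fun j => unitarityFactor R (z j * z i)).prod *
    ((sitesAfter i).map fun j => unitarityFactor R (z j * z i)).prod *
    (boundaryFactor Kp (z i) * boundaryFactor Km (z i))

variable [Nonempty ι] {R : ℂ → Matrix (ι × ι) (ι × ι) ℂ} {Kp Km : ℂ → Matrix ι ι ℂ} {ρ : ℂ}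

theorem isMeromorphicUnit_transferFactor
    (hc : IsMeromorphicUnit {x : ℂ | x ≠ 0} (unitarityFactor R)) (hρ : ρ ≠ 0) (i : Fin N) :
    IsMeromorphicUnit (torus N) (transferFactor R ρ i) :=
  (IsMeromorphicUnit.list_prod _ fun j _ =>
    (hc.comp (isOpenAnalytic_inv.comp (isOpenAnalytic_mul_eval i j))).inv).mul
    (IsMeromorphicUnit.const hρ)

theorem isMeromorphicUnit_transportFactor
    (hc : IsMeromorphicUnit {x : ℂ | x ≠ 0} (unitarityFactor R)) (i : Fin N) :
    IsMeromorphicUnit (torus N) (transportFactor R i) :=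
  IsMeromorphicUnit.list_prod _ fun j hj => by
    have hij : j ≠ i := by
      rintro rfl
      simp [sitesAfter] at hj
    exact (hc.comp (isOpenAnalytic_div.comp (isOpenAnalytic_eval_pair hij))).inv

theorem isMeromorphicUnit_chainFactor
    (hc : IsMeromorphicUnit {x : ℂ | x ≠ 0} (unitarityFactor R))
    (hp : IsMeromorphicUnit {x : ℂ | x ≠ 0} (boundaryFactor Kp))
    (hm : IsMeromorphicUnit {x : ℂ | x ≠ 0} (boundaryFactor Km)) (i : Fin N) :
    IsMeromorphicUnit (torus N) (chainFactor R Kp Km i) :=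
  ((IsMeromorphicUnit.list_prod _ fun j _ => hc.comp (isOpenAnalytic_mul_eval j i)).mul
    (IsMeromorphicUnit.list_prod _ fun j _ => hc.comp (isOpenAnalytic_mul_eval j i))).mul
    ((hp.comp (isOpenAnalytic_eval i)).mul (hm.comp (isOpenAnalytic_eval i)))

theorem generic_boundaryChain_mul_inverse (hz : Generic (torus N) (IsRegularPoint R))
    (hp : BoundaryUnitary Kp) (hm : BoundaryUnitary Km) (i : Fin N) :
    Generic (torus N) fun z => boundaryChain R Kp Km z i * inverseBoundaryChain R Kp Km z i =
      chainFactor R Kp Km i z • 1 :=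
  (hz.and ((hp.generic_mul.comp (isOpenAnalytic_eval i)).and
    (hm.generic_mul.comp (isOpenAnalytic_eval i)))).mono fun _ hz =>
      hz.1.boundaryChain_mul_inverse i hz.2.1.1 hz.2.2.1

theorem proportional_transfer_transport (hz : Generic (torus N) (IsRegularPoint R))
    (hc : IsMeromorphicUnit {x : ℂ | x ≠ 0} (unitarityFactor R)) (hρ : ρ ≠ 0)
    (hR1 : R 1 = ρ • flip) (i : Fin N) :
    Proportional (torus N) (fun z => transferMatrix R (phi (tilde R) Kp) Km (z i) z)
      (fun z => transportMatrix R Kp Km i z 1) := by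
  have hA := isMeromorphicUnit_transportFactor hc i
  have hm := (isMeromorphicUnit_transferFactor hc hρ i).mul hA.inv
  refine ⟨_, hm.meromorphic, hm.ne_zero, (hz.and hA.ne_zero).mono fun z hz => ?_⟩
  have e1 : transferMatrix R (phi (tilde R) Kp) Km (z i) z =
    transferFactor R ρ i z • boundaryChain R Kp Km z i := hz.1.transferMatrix_eq hR1 i
  have e2 : transportMatrix R Kp Km i z 1 = transportFactor R i z • boundaryChain R Kp Km z i :=
    hz.1.transportMatrix_eq i
  simp only
  rw [e1, e2, smul_smul, inv_mul_cancel_right₀ hz.2]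

theorem generic_transport_mul_eq_one (hz : Generic (torus N) (IsRegularPoint R))
    (hc : IsMeromorphicUnit {x : ℂ | x ≠ 0} (unitarityFactor R)) (hKp : MerMatrix Kp)
    (hKm : MerMatrix Km) (hp : BoundaryUnitary Kp) (hm : BoundaryUnitary Km) (i : Fin N) :
    Generic (torus N) fun z => transportFactor R i z * chainFactor R Kp Km i z ≠ 0 ∧
      transportMatrix R Kp Km i z 1 *
        ((transportFactor R i z * chainFactor R Kp Km i z)⁻¹ •
          inverseBoundaryChain R Kp Km z i) = 1 := by
  have hB := isMeromorphicUnit_chainFactor (N := N) hc (hp.isMeromorphicUnit hKp)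
    (hm.isMeromorphicUnit hKm) i
  have hA := isMeromorphicUnit_transportFactor hc i
  refine ((hz.and (generic_boundaryChain_mul_inverse hz hp hm i)).and (hA.mul hB).ne_zero).mono ?_
  rintro z ⟨⟨hz, hBC⟩, hne⟩
  refine ⟨hne, ?_⟩
  have e2 : transportMatrix R Kp Km i z 1 = transportFactor R i z • boundaryChain R Kp Km z i :=
    hz.transportMatrix_eq i
  rw [e2, smul_mul_smul_comm, hBC, smul_smul, mul_right_comm, mul_inv_cancel₀ hne, one_smul]

theorem proportional_transfer_inv_transport (hz : Generic (torus N) (IsRegularPoint R))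
    (hc : IsMeromorphicUnit {x : ℂ | x ≠ 0} (unitarityFactor R)) (hρ : ρ ≠ 0)
    (hR1 : R 1 = ρ • flip) (hKp : MerMatrix Kp) (hKm : MerMatrix Km) (hp : BoundaryUnitary Kp)
    (hm : BoundaryUnitary Km) (i : Fin N) :
    Proportional (torus N) (fun z => transferMatrix R (phi (tilde R) Kp) Km (z i)⁻¹ z)
      (fun z => (transportMatrix R Kp Km i z 1)⁻¹) := by
  have hA := generic_transport_mul_eq_one hz hc hKp hKm hp hm i
  have hmul := (IsMeromorphicUnit.const (U := torus N) (inv_ne_zero hρ)).mul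
    ((isMeromorphicUnit_transportFactor hc i).mul (isMeromorphicUnit_chainFactor (N := N) hc
      (hp.isMeromorphicUnit hKp) (hm.isMeromorphicUnit hKm) i))
  refine ⟨_, hmul.meromorphic, hmul.ne_zero, (hz.and hA).mono ?_⟩
  rintro z ⟨hz, hs, h⟩
  simp only
  rw [hz.transferMatrix_inv_eq hρ hR1, Matrix.inv_eq_right_inv h, smul_smul, mul_assoc,
    mul_inv_cancel₀ hs, mul_one]

theorem generic_commute_transfer (hz : Generic (torus N) (IsRegularPoint R))
    (hc : IsMeromorphicUnit {x : ℂ | x ≠ 0} (unitarityFactor R)) (hρ : ρ ≠ 0)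
    (hR1 : R 1 = ρ • flip) (hKp : MerMatrix Kp) (hKm : MerMatrix Km) (hp : BoundaryUnitary Kp)
    (hm : BoundaryUnitary Km) (hL : LeftReflection R Kp) (hR : RightReflection R Km) :
    Generic (torus N) fun z => ∀ (i j : Fin N) (ε δ : ℤˣ),
      Commute (transferMatrix R (phi (tilde R) Kp) Km (z i ^ (ε : ℤ)) z)
        (transferMatrix R (phi (tilde R) Kp) Km (z j ^ (δ : ℤ)) z) := by
  have hL' : Generic (torus N) fun z => ∀ i j, i ≠ j → LeftReflectionAt R Kp (z i, z j) :=
    Generic.forall_finite fun i => Generic.forall_finite fun j => Generic.imp fun hij =>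
      Generic.comp (P := LeftReflectionAt R Kp) hL (isOpenAnalytic_eval_pair hij)
  have hR' : Generic (torus N) fun z => ∀ i j, i ≠ j → RightReflectionAt R Km (z i, z j) :=
    Generic.forall_finite fun i => Generic.forall_finite fun j => Generic.imp fun hij =>
      Generic.comp (P := RightReflectionAt R Km) hR (isOpenAnalytic_eval_pair hij)
  have hBC := Generic.forall_finite (generic_boundaryChain_mul_inverse hz hp hm)
  have hne := Generic.forall_finite fun i => (isMeromorphicUnit_chainFactor (N := N) hc
    (hp.isMeromorphicUnit hKp) (hm.isMeromorphicUnit hKm) i).ne_zero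
  refine ((hz.and (hL'.and hR')).and (hBC.and hne)).mono ?_
  rintro z ⟨⟨hz, hl, hr⟩, hbc, hne⟩ i j ε δ
  -- All transfer matrices in question are multiples of chains or of their inverses, so commutation
  -- of the chains gives all four sign cases.
  have hB := commute_boundaryChain (hz.boundaryBraiding hl hr)
  have hBC' : ∀ i j, Commute (boundaryChain R Kp Km z i) (inverseBoundaryChain R Kp Km z j) :=
    fun i j => commute_of_mul_eq_smul_one (hne j) (hbc j) (hB i j)
  have hCC : ∀ i j, Commute (inverseBoundaryChain R Kp Km z i)
      (inverseBoundaryChain R Kp Km z j) :=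
    fun i j => commute_of_mul_eq_smul_one (hne j) (hbc j) (hBC' j i).symm
  rcases Int.units_eq_one_or ε with rfl | rfl <;> rcases Int.units_eq_one_or δ with rfl | rfl <;>
    simp only [Units.val_one, Units.val_neg, zpow_one, _root_.zpow_neg, hz.transferMatrix_eq hR1,
      hz.transferMatrix_inv_eq hρ hR1] <;>
    refine Commute.smul_left (Commute.smul_right ?_ _) _
  · exact hB i j
  · exact hBC' i j
  · exact (hBC' j i).symm
  · exact hCC i j

end Main

theorem proportional_of_subsingleton {E : Type*} [NormedAddCommGroup E] [NormedSpace ℂ E]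
    {α : Type*} [Subsingleton (Matrix α α ℂ)] (U : Set E) (X Y : E → Matrix α α ℂ) :
    Proportional U X Y :=
  have h1 := IsMeromorphicUnit.const (U := U) (one_ne_zero (α := ℂ))
  ⟨fun _ => 1, h1.meromorphic, h1.ne_zero, Generic.of_forall fun _ => Subsingleton.elim _ _⟩

end BoundaryQKZ

theorem mainTheorem1 {ι : Type*} [Fintype ι] [DecidableEq ι] (N : ℕ)
    (R : ℂ → Matrix (ι × ι) (ι × ι) ℂ) (Kp Km : ℂ → Matrix ι ι ℂ)
    (hR : BoundaryQKZ.MerMatrix R) (hKp : BoundaryQKZ.MerMatrix Kp)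
    (hKm : BoundaryQKZ.MerMatrix Km)
    (hRinv : BoundaryQKZ.GenericallyInvertible R)
    (hRt : BoundaryQKZ.GenericallyInvertible (fun x => BoundaryQKZ.transposeFst (R x)))
    (hYBE : BoundaryQKZ.YangBaxter R) (hreg : BoundaryQKZ.Regular R)
    (K' : ℂ → Matrix ι ι ℂ) (hK' : K' = BoundaryQKZ.phi (BoundaryQKZ.tilde R) Kp) :
    (∀ i : Fin N, BoundaryQKZ.Proportional (BoundaryQKZ.torus N)
      (fun z => BoundaryQKZ.transferMatrix R K' Km (z i) z)
      (fun z => BoundaryQKZ.transportMatrix R Kp Km i z 1)) ∧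
    (BoundaryQKZ.BoundaryUnitary Kp → BoundaryQKZ.BoundaryUnitary Km →
      (∀ i : Fin N,
        BoundaryQKZ.Generic (BoundaryQKZ.torus N)
          (fun z => IsUnit (BoundaryQKZ.transportMatrix R Kp Km i z 1)) ∧
        BoundaryQKZ.Proportional (BoundaryQKZ.torus N)
          (fun z => BoundaryQKZ.transferMatrix R K' Km (z i)⁻¹ z)
          (fun z => (BoundaryQKZ.transportMatrix R Kp Km i z 1)⁻¹)) ∧
      (BoundaryQKZ.LeftReflection R Kp → BoundaryQKZ.RightReflection R Km →
        BoundaryQKZ.Generic (BoundaryQKZ.torus N) (fun z => ∀ (i j : Fin N) (ε δ : ℤˣ),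
          Commute (BoundaryQKZ.transferMatrix R K' Km (z i ^ (ε : ℤ)) z)
            (BoundaryQKZ.transferMatrix R K' Km (z j ^ (δ : ℤ)) z)))) := by
  subst hK'
  -- Unitarity scalars are read off at a basis vector, so `V = 0` is separate; there any site `i`
  -- forces `V^{⊗N} = 0`, where every claim is trivial.
  rcases isEmpty_or_nonempty ι with hι | hι
  · have hs : Fin N → Subsingleton (Matrix (Fin N → ι) (Fin N → ι) ℂ) := fun i =>
      have : IsEmpty (Fin N → ι) := ⟨fun f => hι.elim (f i)⟩
      inferInstance
    refine ⟨fun i => ?_, fun _ _ => ⟨fun i => ⟨BoundaryQKZ.Generic.of_forall fun z => ?_, ?_⟩,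
      fun _ _ => BoundaryQKZ.Generic.of_forall fun z i j ε δ => ?_⟩⟩ <;> have := hs i
    · exact BoundaryQKZ.proportional_of_subsingleton _ _ _
    · exact isUnit_of_subsingleton _
    · exact BoundaryQKZ.proportional_of_subsingleton _ _ _
    · exact Subsingleton.elim _ _
  obtain ⟨-, ρ, hρ, hR1⟩ := id hreg
  have hU := BoundaryQKZ.generic_isUnitaryAt hR hRinv hRt hYBE hreg
  have hz := BoundaryQKZ.generic_isRegularPoint (N := N) hYBE hU
  have hc := BoundaryQKZ.isMeromorphicUnit_unitarityFactor hR hU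
  refine ⟨BoundaryQKZ.proportional_transfer_transport hz hc hρ hR1, fun hp hm => ⟨fun i =>
    ⟨(BoundaryQKZ.generic_transport_mul_eq_one hz hc hKp hKm hp hm i).mono fun z h =>
      IsUnit.of_mul_eq_one _ h.2,
    BoundaryQKZ.proportional_transfer_inv_transport hz hc hρ hR1 hKp hKm hp hm i⟩,
    BoundaryQKZ.generic_commute_transfer hz hc hρ hR1 hKp hKm hp hm⟩⟩
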